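/- **Theorem (Adaptive Composition of Pure Typically Stable Algorithms).** *Definitions.* Let $\mathcal{X}$ be a measurable space, $n\in\mathbb{N}$, and $\mathcal{P}$ a family of probability distributions on $\mathcal{X}^n$. Output spaces are measurable spaces with countably generated $\sigma$-algebras, and randomized algorithms are Markov kernels. Two probability distributions $\mu,\mu'$ on the same space are $(\eta,\tau)$-indistinguishable, $\mu\approx_{\eta,\tau}\mu'$, if $\mu(O)\le e^{\eta}\mu'(O)+\tau$ and $\mu'(O)\le e^{\eta}\mu(O)+\tau$ for every measurable $O$. A randomized algorithm $\mathcal{A}:\mathcal{X}^n\to\mathcal{Z}$ is $(\eta,\tau,\nu)$-typically stable with respect to $\mathcal{P}$ if for every $\mathbf{P}\in\mathcal{P}$ there is a probability distribution $\mathcal{W}(\mathbf{P})$ on $\mathcal{Z}$ such that, with probability at least $1-\nu$ over $\mathbf{X}\sim\mathbf{P}$, the output distribution of $\mathcal{A}(\mathbf{X})$ is $(\eta,\tau)$-indistinguishable from $\mathcal{W}(\mathbf{P})$. Let $\mathcal{A}_i:\mathcal{X}^n\times\mathcal{Z}_1\times\dots\times\mathcal{Z}_{i-1}\to\mathcal{Z}_i$,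 $i=1,\dots,k$, be randomized algorithms. Their $k$-fold adaptive composition $\mathcal{M}^k$, on input $\mathbf{x}\in\mathcal{X}^n$, draws successively $z_i=\mathcal{A}_i(\mathbf{x},z_1,\dots,z_{i-1})$ with fresh random coins and returns $(z_1,\dots,z_k)$. *Statement.* Let $k\ge 2$, $\eta>0$, $0\le\nu<1$, $0<\tau'<1$, and let $\mathcal{A}_1,\dots,\mathcal{A}_k$ be such that for every $i\le k$ and every $(z_1,\dots,z_{i-1})$ the algorithm $\mathcal{A}_i(\cdot,z_1,\dots,z_{i-1})$ is $(\eta,0,\nu)$-typically stable with respect to $\mathcal{P}$. Then $\mathcal{M}^k$ is $(\eta^*,\tau^*,\nu^*)$-typically stable with respect to $\mathcal{P}$, where, with $\eta_t=\sqrt{2t\log(1/\tau')}\,\eta+t\eta(e^{\eta}-1)$ and $\log$ the natural logarithm, $$\eta^*=3\sqrt{2k\log(1/\tau')}\,\eta+3k\eta(e^{\eta}-1),\qquad \tau^*=\nu^*=5\left(\frac{k\tau'}{\eta}+\frac{\nu}{\eta}+\sum_{t=1}^{k-1}e^{\eta_t}\frac{\nu}{\eta}\right)^{1/2}.$$ In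 particular, for $\eta=O(\sqrt{\log(1/\tau')/k})$: for every $c>0$ there is a constant $A>0$ depending only on $c$ such that, whenever in addition $\eta\le c\sqrt{\log(1/\tau')/k}$, the composition $\mathcal{M}^k$ is $(\eta',\nu',\nu')$-typically stable with respect to $\mathcal{P}$, where $$\eta'=A\sqrt{\log(1/\tau')}\,\sqrt{k}\,\eta,\qquad \nu'=A\left(\sqrt{k\tau'/\eta}+\sqrt{k\nu/\eta}\;e^{A\sqrt{\log(1/\tau')}\sqrt{k}\,\eta}\right).$$ -/

import Mathlib

open MeasureTheory ProbabilityTheory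

universe u v

/-- `(η, τ)`-indistinguishability of two distributions `μ`, `μ'` on the same space. -/
def Indistinguishable {Z : Type*} [MeasurableSpace Z] (η τ : ℝ) (μ μ' : Measure Z) : Prop :=
  ∀ O : Set Z, MeasurableSet O →
    μ.real O ≤ Real.exp η * μ'.real O + τ ∧ μ'.real O ≤ Real.exp η * μ.real O + τ

/-- A randomized algorithm `𝒜` from data sets `D` to outputs `Z` (a Markov kernel: `𝒜 x` is the
output distribution on input `x`) is `(η, τ, ν)`-typically stable with respect to the family `𝓟`
if every `P ∈ 𝓟` has an oracle output distribution `W` with `𝒜 X ≈_{η, τ} W` with probability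
at least `1 - ν` over `X ∼ P`. -/
def TypicallyStable {D Z : Type*} [MeasurableSpace D] [MeasurableSpace Z]
    (𝓟 : Set (ProbabilityMeasure D)) (𝒜 : Kernel D Z) (η τ ν : ℝ) : Prop :=
  ∀ P ∈ 𝓟, ∃ W : ProbabilityMeasure Z,
    1 - ν ≤ (P : Measure D).real {x | Indistinguishable η τ (𝒜 x) (W : Measure Z)}

/-- Append the output `z_{j+1}` to the transcript `(z_1, …, z_j)`. -/
def appendOutput (Z : ℕ → Type*) (j : ℕ) (p : (∀ i : Fin j, Z i) × Z j) :
    ∀ i : Fin (j + 1), Z i :=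
  Fin.snoc (α := fun i : Fin (j + 1) => Z i) p.1 p.2

theorem measurable_appendOutput (Z : ℕ → Type*) [∀ i, MeasurableSpace (Z i)] (j : ℕ) :
    Measurable (appendOutput Z j) := by
  refine measurable_pi_lambda _ fun i => ?_
  induction i using Fin.lastCases with
  | last =>
    have h : (fun p : (∀ i : Fin j, Z i) × Z j => appendOutput Z j p (Fin.last j)) =
        fun p => p.2 := by
      funext p
      exact Fin.snoc_last (α := fun i : Fin (j + 1) => Z i) _ _
    rw [h]
    exact measurable_snd
  | cast i =>
    have h : (fun p : (∀ i : Fin j, Z i) × Z j => appendOutput Z j p i.castSucc) =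
        fun p => p.1 i := by
      funext p
      exact Fin.snoc_castSucc (α := fun i : Fin (j + 1) => Z i) _ _ _
    rw [h]
    exact (measurable_pi_apply i).comp measurable_fst

/-- The adaptive composition `ℳ^k`: on input `x`, having produced `z = (z_1, …, z_j)`, draw the
next output from `𝒜 j (x, z)` with fresh coins and append it; return the first `k` outputs.
The algorithms are numbered from `0`, and those numbered `k` or more play no role in `ℳ^k`. -/
noncomputable def adaptiveComposition {D : Type*} [MeasurableSpace D] {Z : ℕ → Type*}
    [∀ i, MeasurableSpace (Z i)] (𝒜 : ∀ i : ℕ, Kernel (D × (∀ j : Fin i, Z j)) (Z i)) :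
    ∀ k : ℕ, Kernel D (∀ i : Fin k, Z i)
  | 0 => Kernel.const D (Measure.dirac fun i => i.elim0)
  | k + 1 => ((adaptiveComposition 𝒜 k).compProd (𝒜 k)).map (appendOutput Z k)

instance isMarkovKernel_adaptiveComposition {D : Type*} [MeasurableSpace D] {Z : ℕ → Type*}
    [∀ i, MeasurableSpace (Z i)] (𝒜 : ∀ i : ℕ, Kernel (D × (∀ j : Fin i, Z j)) (Z i))
    [∀ i, IsMarkovKernel (𝒜 i)] (k : ℕ) : IsMarkovKernel (adaptiveComposition 𝒜 k) := by
  induction k with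
  | zero => unfold adaptiveComposition; infer_instance
  | succ k ih =>
    unfold adaptiveComposition
    exact Kernel.IsMarkovKernel.map _ (measurable_appendOutput Z k)

/-- The class of `(η, τ, ν)`-typically stable algorithms w.r.t. `𝓟` satisfies
`(η', τ', ν')`-typical stability w.r.t. `𝓟` under `k`-fold adaptive composition: for all adaptively
chosen sequences of algorithms such that, for every transcript `z` of earlier outputs, the algorithm
`𝒜 i (·, z)` is `(η, τ, ν)`-typically stable, the composition is `(η', τ', ν')`-typically stable. -/
def SatisfiesStabilityUnderComposition {D : Type u} [MeasurableSpace D]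
    (𝓟 : Set (ProbabilityMeasure D)) (k : ℕ) (η τ ν η' τ' ν' : ℝ) : Prop :=
  ∀ (Z : ℕ → Type v) [∀ i, MeasurableSpace (Z i)]
    [∀ i, MeasurableSpace.CountablyGenerated (Z i)]
    (𝒜 : ∀ i : ℕ, Kernel (D × (∀ j : Fin i, Z j)) (Z i)) [∀ i, IsMarkovKernel (𝒜 i)],
    (∀ i < k, ∀ z : ∀ j : Fin i, Z j, TypicallyStable 𝓟 ((𝒜 i).sectL z) η τ ν) →
      TypicallyStable 𝓟 (adaptiveComposition 𝒜 k) η' τ' ν'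

/-- `η_t = √(2 t log(1/τ')) η + t η (e^η - 1)`. -/
noncomputable def etaStep (η τ' : ℝ) (t : ℕ) : ℝ :=
  Real.sqrt (2 * t * Real.log (1 / τ')) * η + t * η * (Real.exp η - 1)

/-- `η* = 3 √(2 k log(1/τ')) η + 3 k η (e^η - 1)`. -/
noncomputable def etaStar (k : ℕ) (η τ' : ℝ) : ℝ :=
  3 * Real.sqrt (2 * k * Real.log (1 / τ')) * η + 3 * k * η * (Real.exp η - 1)

/-- `τ* = ν* = 5 (k τ'/η + ν/η + ∑_{t=1}^{k-1} e^{η_t} ν/η)^{1/2}`. -/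
noncomputable def nuStar (k : ℕ) (η ν τ' : ℝ) : ℝ :=
  5 * Real.sqrt (k * τ' / η + ν / η + ∑ t ∈ Finset.Ico 1 k, Real.exp (etaStep η τ' t) * ν / η)

/-- `A √(log(1/τ')) √k η`, the form of an `Õ(√k η)` term with constant `A`. -/
noncomputable def etaAsymp (A : ℝ) (k : ℕ) (η τ' : ℝ) : ℝ :=
  A * Real.sqrt (Real.log (1 / τ')) * (Real.sqrt k * η)

/-- `A (√(k τ'/η) + √(k ν/η) e^{Õ(√k η)})` with constant `A` in the `Õ` as well. -/
noncomputable def nuAsymp (A : ℝ) (k : ℕ) (η ν τ' : ℝ) : ℝ :=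
  A * (Real.sqrt (k * τ' / η) + Real.sqrt (k * ν / η) * Real.exp (etaAsymp A k η τ'))

/-! Fix `P`. The candidate oracle for the composition is the law `W_k` of the transcript obtained
when every algorithm is replaced by its own oracle `V_i`. This law does not see the data. Suppose
that every likelihood ratio `q_i = dA_i/dV_i` had values in `[e^{-η}, e^η]`. Then `ρ_k = ∏ q_i`
would be the density of the composition with respect to `W_k`. By convexity each factor has
conditional moments `∫ q^{l+1} ≤ exp(l(l+1)η²/2)`, with the same bound for `∫ q^{-l}`. These bounds
multiply along the transcript, and a Chernoff bound gives `|log ρ_k| ≤ √(2kL) η + kη²/2` off events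
of probability of order `e^{-L}`, where `L = log(1/τ')`.

Two things stand in the way. First, the oracles are given separately for each transcript, with no
measurability. Each of them has a bounded density with respect to the average output over the data,
and on a countably generated space such densities are approximated by a fixed sequence. Selecting
the first good member is measurable (`exists_measurable_oracle`). The approximation error is
absorbed by replacing `η` with a slightly larger `η'` and discarding sets of mass at most `δ`; both
enlargements are as small as desired.

Second, stability holds for most data at a fixed transcript, whereas the actual transcript depends
on the data. So `q_i` is cut to zero wherever the data are bad or the ratio is out of range, and the
lost mass is counted. Where `ρ_t ≤ e^{η_t}`, the law of the first `t` outputs is at most `e^{η_t}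
W_t`. As `W_t` is independent of the data, Fubini bounds the average loss at the next step by
`e^{η_t} ν`, plus the tail of `ρ_t` (`one_le_lintegral_transcriptDensity_add`). This is the origin
of the sum in `ν*`. Markov's inequality over the data, with threshold and failure probability of the
same order, gives the square root.

For `η > 2` concentration is not needed: `t η (e^η - 1)` exceeds the plain sum of the losses by
enough to absorb the factor `1/η`. -/

open scoped ENNReal NNReal symmDiff

/-! ### Hyperbolic inequalities and the chord of a power -/

theorem sinh_le_mul_cosh {u : ℝ} (hu : 0 ≤ u) : Real.sinh u ≤ u * Real.cosh u := by
  have hd : ∀ x : ℝ, HasDerivAt (fun x => x * Real.cosh x - Real.sinh x) (x * Real.sinh x) x := by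
    intro x
    have h := ((hasDerivAt_id x).mul (Real.hasDerivAt_cosh x)).sub (Real.hasDerivAt_sinh x)
    exact h.congr_deriv (by simp only [id_eq]; ring)
  have hm : MonotoneOn (fun x => x * Real.cosh x - Real.sinh x) (Set.Ici 0) := by
    refine monotoneOn_of_deriv_nonneg (convex_Ici 0)
      (fun x _ => (hd x).continuousAt.continuousWithinAt)
      (fun x _ => (hd x).differentiableAt.differentiableWithinAt) fun x hx => ?_
    rw [interior_Ici] at hx
    rw [(hd x).deriv]
    exact mul_nonneg hx.le (Real.sinh_nonneg_iff.2 hx.le)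
  have h := hm (Set.mem_Ici.2 le_rfl) (Set.mem_Ici.2 hu) hu
  simp only [Real.cosh_zero, Real.sinh_zero, mul_one, sub_zero] at h
  linarith

/-- Since `tanh u ≤ u`, the addition formula is at most `cosh u cosh v (1 + u v)`. With `u = l η`
and `v = η / 2` the exponent becomes `l (l + 1) η² / 2`. -/
theorem cosh_add_le {u v : ℝ} (hu : 0 ≤ u) (hv : 0 ≤ v) :
    Real.cosh (u + v) ≤ Real.cosh v * Real.exp (u ^ 2 / 2 + u * v) := by
  rw [Real.cosh_add, Real.exp_add]
  have h1 := Real.cosh_le_exp_half_sq u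
  have h2 : u * v + 1 ≤ Real.exp (u * v) := Real.add_one_le_exp _
  have hcu := Real.cosh_pos u
  have hcv := Real.cosh_pos v
  calc Real.cosh u * Real.cosh v + Real.sinh u * Real.sinh v
      ≤ Real.cosh u * Real.cosh v + (u * Real.cosh u) * (v * Real.cosh v) := by
        gcongr
        · exact sinh_le_mul_cosh hu
        · exact sinh_le_mul_cosh hv
    _ = Real.cosh v * (Real.cosh u * (u * v + 1)) := by ring
    _ ≤ _ := by gcongr

/-- The chord of `s ↦ s ^ (l + 1)` over `[e^{-η}, e^η]` lies above the graph. -/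
theorem rpow_add_le_chord {η l s : ℝ} (hη : 0 < η) (hl : 0 ≤ l) (h1 : Real.exp (-η) ≤ s)
    (h2 : s ≤ Real.exp η) :
    s ^ (l + 1) + Real.sinh (l * η) / Real.sinh η ≤
      Real.sinh ((l + 1) * η) / Real.sinh η * s := by
  have hlt : Real.exp (-η) < Real.exp η := Real.exp_lt_exp.2 (by linarith)
  have hD : 0 < Real.exp η - Real.exp (-η) := by linarith
  have hc := (convexOn_rpow (p := l + 1) (by linarith)).2
    (Set.mem_Ici.2 (Real.exp_pos (-η)).le) (Set.mem_Ici.2 (Real.exp_pos η).le)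
    (div_nonneg (sub_nonneg.2 h2) hD.le) (div_nonneg (sub_nonneg.2 h1) hD.le)
    (by field_simp; ring)
  simp only [smul_eq_mul] at hc
  have hs : (Real.exp η - s) / (Real.exp η - Real.exp (-η)) * Real.exp (-η) +
      (s - Real.exp (-η)) / (Real.exp η - Real.exp (-η)) * Real.exp η = s := by
    field_simp; ring
  rw [hs, ← Real.exp_mul, ← Real.exp_mul] at hc
  have hMN : Real.exp η * Real.exp (-η) = 1 := by rw [← Real.exp_add]; simp
  have e1 : Real.exp (-η * (l + 1)) = Real.exp (-η) * Real.exp (-(l * η)) := by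
    rw [← Real.exp_add]; ring_nf
  have e2 : Real.exp (η * (l + 1)) = Real.exp η * Real.exp (l * η) := by
    rw [← Real.exp_add]; ring_nf
  have e3 : Real.sinh ((l + 1) * η) = (Real.exp η * Real.exp (l * η) -
      Real.exp (-η) * Real.exp (-(l * η))) / 2 := by
    rw [Real.sinh_eq, ← Real.exp_add, ← Real.exp_add]; ring_nf
  rw [e1, e2] at hc
  have hsh : 0 < Real.sinh η := Real.sinh_pos_iff.2 hη
  have hsh' : Real.sinh η = (Real.exp η - Real.exp (-η)) / 2 := Real.sinh_eq η
  rw [← sub_nonneg] at hc ⊢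
  refine hc.trans_eq ?_
  rw [e3, Real.sinh_eq (l * η), hsh']
  generalize Real.exp (l * η) = Q
  generalize Real.exp (-(l * η)) = R
  field_simp
  linear_combination (R - Q) * hMN

/-- The difference of the two quotients is `cosh((l + 1/2) η) / cosh(η / 2)`. This is the moment of
order `l + 1` in the extremal case, where the ratio takes only the values `e^{±η}` and has mean one.
-/
theorem sinh_chord_le {η l : ℝ} (hη : 0 < η) (hl : 0 ≤ l) :
    Real.sinh ((l + 1) * η) / Real.sinh η ≤
      Real.exp (l * (l + 1) * η ^ 2 / 2) + Real.sinh (l * η) / Real.sinh η := by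
  have hsh : 0 < Real.sinh η := Real.sinh_pos_iff.2 hη
  have h := cosh_add_le (u := l * η) (v := η / 2) (by positivity) (by positivity)
  have hs2 : 0 < Real.sinh (η / 2) := Real.sinh_pos_iff.2 (by positivity)
  have e1 : Real.sinh ((l + 1) * η) - Real.sinh (l * η) =
      2 * Real.cosh (l * η + η / 2) * Real.sinh (η / 2) := by
    have a1 : (l + 1) * η = (l * η + η / 2) + η / 2 := by ring
    have a2 : l * η = (l * η + η / 2) - η / 2 := by ring
    have a3 := Real.sinh_sub (l * η + η / 2) (η / 2)
    rw [← a2] at a3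
    rw [a1, Real.sinh_add, a3]; ring
  have e2 : Real.sinh η = 2 * Real.sinh (η / 2) * Real.cosh (η / 2) := by
    rw [← Real.sinh_two_mul]; ring_nf
  have e3 : (l * η) ^ 2 / 2 + l * η * (η / 2) = l * (l + 1) * η ^ 2 / 2 := by ring
  rw [e3] at h
  rw [← sub_le_iff_le_add, ← sub_div, div_le_iff₀ hsh, e1, e2]
  nlinarith

/-! ### Moments of likelihood ratios -/

/-- The range `[e^{-η}, e^η]` of likelihood ratios of privacy loss at most `η`. -/
noncomputable def ratioRange (η : ℝ) : Set ℝ≥0∞ :=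
  Set.Icc (ENNReal.ofReal (Real.exp (-η))) (ENNReal.ofReal (Real.exp η))

theorem measurableSet_ratioRange (η : ℝ) : MeasurableSet (ratioRange η) := measurableSet_Icc

theorem exists_ofReal_of_mem_ratioRange {η : ℝ} {r : ℝ≥0∞} (hr : r ∈ ratioRange η) :
    ∃ s : ℝ, r = ENNReal.ofReal s ∧ Real.exp (-η) ≤ s ∧ s ≤ Real.exp η := by
  have hfin : r ≠ ∞ := ne_top_of_le_ne_top ENNReal.ofReal_ne_top hr.2
  refine ⟨r.toReal, (ENNReal.ofReal_toReal hfin).symm, ?_, ?_⟩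
  · exact (ENNReal.ofReal_le_iff_le_toReal hfin).1 hr.1
  · exact ENNReal.toReal_le_of_le_ofReal (Real.exp_pos _).le hr.2

theorem ratioRange_chord {η l : ℝ} (hη : 0 < η) (hl : 0 ≤ l) {r : ℝ≥0∞} (hr : r ∈ ratioRange η) :
    r ^ (l + 1) + ENNReal.ofReal (Real.sinh (l * η) / Real.sinh η) ≤
      ENNReal.ofReal (Real.sinh ((l + 1) * η) / Real.sinh η) * r := by
  obtain ⟨s, rfl, h1, h2⟩ := exists_ofReal_of_mem_ratioRange hr
  have hs : 0 < s := (Real.exp_pos _).trans_le h1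
  have hsh : 0 < Real.sinh η := Real.sinh_pos_iff.2 hη
  have hg : 0 ≤ Real.sinh (l * η) := Real.sinh_nonneg_iff.2 (by positivity)
  have hb : 0 ≤ Real.sinh ((l + 1) * η) := Real.sinh_nonneg_iff.2 (by positivity)
  rw [ENNReal.ofReal_rpow_of_pos hs, ← ENNReal.ofReal_add (by positivity) (by positivity),
    ← ENNReal.ofReal_mul (by positivity)]
  exact ENNReal.ofReal_le_ofReal (rpow_add_le_chord hη hl h1 h2)

/-- The range is invariant under inversion, so the chord inequality holds at `1 / s`; multiplying it
by `s` gives this form. All terms are kept positive because subtraction in `ℝ≥0∞` truncates. -/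
theorem ratioRange_chord_neg {η l : ℝ} (hη : 0 < η) (hl : 0 ≤ l) {r : ℝ≥0∞}
    (hr : r ∈ ratioRange η) :
    r ^ (-l) + ENNReal.ofReal (Real.sinh (l * η) / Real.sinh η) * r ≤
      ENNReal.ofReal (Real.sinh ((l + 1) * η) / Real.sinh η) := by
  obtain ⟨s, rfl, h1, h2⟩ := exists_ofReal_of_mem_ratioRange hr
  have hs : 0 < s := (Real.exp_pos _).trans_le h1
  have hsh : 0 < Real.sinh η := Real.sinh_pos_iff.2 hη
  have hg : 0 ≤ Real.sinh (l * η) := Real.sinh_nonneg_iff.2 (by positivity)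
  rw [ENNReal.ofReal_rpow_of_pos hs, ← ENNReal.ofReal_mul (by positivity),
    ← ENNReal.ofReal_add (by positivity) (by positivity)]
  refine ENNReal.ofReal_le_ofReal ?_
  have h := rpow_add_le_chord (s := s⁻¹) hη hl
    (by rw [Real.exp_neg]; exact inv_anti₀ hs h2)
    (by rw [← neg_neg η, Real.exp_neg (-η)]; exact inv_anti₀ (Real.exp_pos _) h1)
  have h' := mul_le_mul_of_nonneg_right h hs.le
  have e : (s⁻¹) ^ (l + 1) * s = s ^ (-l) := by
    rw [Real.inv_rpow hs.le, Real.rpow_add hs, Real.rpow_one, Real.rpow_neg hs.le]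
    field_simp
  rw [add_mul, e, mul_assoc _ s⁻¹ s, inv_mul_cancel₀ hs.ne', mul_one] at h'
  exact h'

/-- The bound on the moments of order `l` of the truncated likelihood ratio. -/
noncomputable def momentBound (η l δ : ℝ) : ℝ :=
  Real.exp (l * (l + 1) * η ^ 2 / 2) + Real.sinh (l * η) / Real.sinh η * δ

/-- Shared end of both moment bounds: `c` is the mass of the pure region, and its deficit `δ` costs
`δ` times the intercept or slope of the chord. -/
theorem le_momentBound {η l δ : ℝ} (hη : 0 < η) (hl : 0 ≤ l) (hδ : 0 ≤ δ) {I c : ℝ≥0∞}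
    (hc : 1 ≤ c + ENNReal.ofReal δ)
    (h : I + ENNReal.ofReal (Real.sinh (l * η) / Real.sinh η) * c ≤
      ENNReal.ofReal (Real.sinh ((l + 1) * η) / Real.sinh η)) :
    I ≤ ENNReal.ofReal (momentBound η l δ) := by
  have hsh : 0 < Real.sinh η := Real.sinh_pos_iff.2 hη
  have hg : 0 ≤ Real.sinh (l * η) / Real.sinh η :=
    div_nonneg (Real.sinh_nonneg_iff.2 (by positivity)) hsh.le
  set g := Real.sinh (l * η) / Real.sinh η with hgdef
  refine (ENNReal.add_le_add_iff_right (a := ENNReal.ofReal g) ENNReal.ofReal_ne_top).1 ?_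
  calc I + ENNReal.ofReal g ≤ I + ENNReal.ofReal g * (c + ENNReal.ofReal δ) := by
        gcongr
        exact le_mul_of_one_le_right (by simp) hc
    _ = I + ENNReal.ofReal g * c + ENNReal.ofReal (g * δ) := by
        rw [mul_add, ENNReal.ofReal_mul hg, add_assoc]
    _ ≤ ENNReal.ofReal (Real.exp (l * (l + 1) * η ^ 2 / 2) + g) + ENNReal.ofReal (g * δ) := by
        gcongr
        exact h.trans (ENNReal.ofReal_le_ofReal (sinh_chord_le hη hl))
    _ = ENNReal.ofReal (momentBound η l δ) + ENNReal.ofReal g := by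
        have := Real.exp_pos (l * (l + 1) * η ^ 2 / 2)
        rw [← ENNReal.ofReal_add (by positivity) (by positivity),
          ← ENNReal.ofReal_add (by unfold momentBound; positivity) hg, momentBound,
          ← hgdef, add_right_comm]

section Moments

variable {Z : Type*} [MeasurableSpace Z] {v : Measure Z} {r : Z → ℝ≥0∞}

/-- Integrate the chord inequality over the pure region. The linear term is controlled by `∫ r ≤ 1`,
the constant term by the `v`-mass being at least `1 - δ`. For negative powers these two masses
exchange roles. -/
theorem setLIntegral_rpow_le_momentBound (hr : Measurable r) {η l δ : ℝ} (hη : 0 < η)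
    (hl : 0 ≤ l) (hδ : 0 ≤ δ) (h1 : ∫⁻ y in r ⁻¹' ratioRange η, r y ∂v ≤ 1)
    (hv : 1 ≤ v (r ⁻¹' ratioRange η) + ENNReal.ofReal δ) :
    ∫⁻ y in r ⁻¹' ratioRange η, r y ^ (l + 1) ∂v ≤ ENNReal.ofReal (momentBound η l δ) := by
  have hS : MeasurableSet (r ⁻¹' ratioRange η) := hr (measurableSet_ratioRange η)
  refine le_momentBound hη hl hδ hv ?_
  calc _ = ∫⁻ y in r ⁻¹' ratioRange η,
        (r y ^ (l + 1) + ENNReal.ofReal (Real.sinh (l * η) / Real.sinh η)) ∂v := by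
        rw [lintegral_add_right _ measurable_const, setLIntegral_const]
    _ ≤ ∫⁻ y in r ⁻¹' ratioRange η,
        ENNReal.ofReal (Real.sinh ((l + 1) * η) / Real.sinh η) * r y ∂v :=
        setLIntegral_mono (hr.const_mul _) fun y hy => ratioRange_chord hη hl hy
    _ ≤ _ := by
        rw [lintegral_const_mul _ hr]
        exact mul_le_of_le_one_right (by simp) h1

theorem setLIntegral_rpow_neg_le_momentBound [IsProbabilityMeasure v] (hr : Measurable r)
    {η l δ : ℝ} (hη : 0 < η) (hl : 0 ≤ l) (hδ : 0 ≤ δ)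
    (hv : 1 ≤ ∫⁻ y in r ⁻¹' ratioRange η, r y ∂v + ENNReal.ofReal δ) :
    ∫⁻ y in r ⁻¹' ratioRange η, r y ^ (-l) ∂v ≤ ENNReal.ofReal (momentBound η l δ) := by
  have hS : MeasurableSet (r ⁻¹' ratioRange η) := hr (measurableSet_ratioRange η)
  refine le_momentBound hη hl hδ hv ?_
  rw [← lintegral_const_mul _ hr, ← lintegral_add_right _ (hr.const_mul _)]
  calc _ ≤ ∫⁻ y in r ⁻¹' ratioRange η,
        ENNReal.ofReal (Real.sinh ((l + 1) * η) / Real.sinh η) ∂v :=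
        setLIntegral_mono measurable_const fun y hy => ratioRange_chord_neg hη hl hy
    _ ≤ _ := by
        rw [setLIntegral_const]
        exact mul_le_of_le_one_right (by simp) prob_le_one

end Moments

/-! ### From indistinguishability to bounded ratios -/

/-- The likelihood ratio `da/dv` lies in `[e^{-η}, e^η]` off a set of measure at most `δ` for `v`
and for `a`. -/
def NearlyPure {Z : Type*} [MeasurableSpace Z] (η : ℝ) (δ : ℝ≥0∞) (a v : Measure Z) : Prop :=
  1 ≤ v (a.rnDeriv v ⁻¹' ratioRange η) + δ ∧
    1 ≤ ∫⁻ y in a.rnDeriv v ⁻¹' ratioRange η, a.rnDeriv v y ∂v + δ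

/-- On a set where the ratio is below `e^{-η'}`, one has `a ≤ e^{-η'} v`. Inserted in `v ≤ e^η a +
δ`, this gives `v ≤ e^{η-η'} v + δ`, which can be solved for `v` because `η < η'`. Large ratios are
symmetric, and the two exceptional sets account for the factor `2`. -/
theorem Indistinguishable.nearlyPure {Z : Type*} [MeasurableSpace Z] {η η' δ : ℝ}
    {a v : Measure Z} [IsProbabilityMeasure a] [IsProbabilityMeasure v] (hη₀ : 0 ≤ η)
    (hη : η < η') (h : Indistinguishable η δ a v) :
    NearlyPure η' (ENNReal.ofReal (2 * (δ / (1 - Real.exp (η - η'))))) a v := by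
  unfold NearlyPure
  have hr : Measurable (a.rnDeriv v) := Measure.measurable_rnDeriv a v
  obtain ⟨S, hS, hSs, hSv⟩ := Measure.mutuallySingular_singularPart a v
  set γ := δ / (1 - Real.exp (η - η')) with hγ
  have hden : 0 < 1 - Real.exp (η - η') := by
    have : Real.exp (η - η') < 1 := Real.exp_lt_one_iff.2 (by linarith)
    linarith
  have key : ∀ O, MeasurableSet O →
      a O = a.singularPart v O + ∫⁻ y in O, a.rnDeriv v y ∂v := by
    intro O hO
    conv_lhs => rw [← Measure.singularPart_add_rnDeriv a v]
    rw [Measure.add_apply, withDensity_apply _ hO]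
  generalize a.rnDeriv v = r at hr key ⊢
  have solve : ∀ b : ℝ, b ≤ Real.exp (η - η') * b + δ → b ≤ γ := by
    intro b hb
    rw [hγ, le_div_iff₀ hden]; linarith
  have hexp : Real.exp (-η') ≤ 1 := Real.exp_le_one_iff.2 (by linarith)
  set E2 := {y | r y < ENNReal.ofReal (Real.exp (-η'))} ∩ S with hE2
  have hE2m : MeasurableSet E2 := (measurableSet_lt hr measurable_const).inter hS
  have ha2 : a.real E2 ≤ Real.exp (-η') * v.real E2 := by
    have h0 : a E2 ≤ ENNReal.ofReal (Real.exp (-η')) * v E2 := by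
      rw [key _ hE2m, measure_mono_null Set.inter_subset_right hSs, zero_add, ← setLIntegral_const]
      exact setLIntegral_mono measurable_const fun y hy => hy.1.le
    have := ENNReal.toReal_mono (by finiteness) h0
    rwa [ENNReal.toReal_mul, ENNReal.toReal_ofReal (Real.exp_pos _).le] at this
  have hv2 : v.real E2 ≤ γ := by
    apply solve
    have h1 := (h E2 hE2m).2
    have h2 := mul_le_mul_of_nonneg_left ha2 (Real.exp_pos η).le
    rw [← mul_assoc, ← Real.exp_add, ← sub_eq_add_neg] at h2
    linarith
  have ha2' : a.real E2 ≤ γ :=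
    ha2.trans ((mul_le_of_le_one_left measureReal_nonneg hexp).trans hv2)
  -- `Sᶜ` carries the singular part of `a` and is `v`-null, so it counts as a region of infinite
  -- ratio.
  set E1 := {y | ENNReal.ofReal (Real.exp η') < r y} ∪ Sᶜ with hE1
  have hE1m : MeasurableSet E1 := (measurableSet_lt measurable_const hr).union hS.compl
  have hv1 : v.real E1 ≤ Real.exp (-η') * a.real E1 := by
    have h0 : ENNReal.ofReal (Real.exp η') * v E1 ≤ a E1 := by
      calc _ ≤ ENNReal.ofReal (Real.exp η') * v {y | ENNReal.ofReal (Real.exp η') < r y} := by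
            refine mul_le_mul_right ?_ _
            exact (measure_union_le _ _).trans (by rw [hSv, add_zero])
        _ = ∫⁻ y in {y | ENNReal.ofReal (Real.exp η') < r y}, ENNReal.ofReal (Real.exp η') ∂v :=
            (setLIntegral_const _ _).symm
        _ ≤ ∫⁻ y in {y | ENNReal.ofReal (Real.exp η') < r y}, r y ∂v :=
            setLIntegral_mono hr fun y hy => le_of_lt hy
        _ ≤ ∫⁻ y in E1, r y ∂v := lintegral_mono_set Set.subset_union_left
        _ ≤ a E1 := by rw [key _ hE1m]; exact le_add_self
    have := ENNReal.toReal_mono (by finiteness) h0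
    rw [ENNReal.toReal_mul, ENNReal.toReal_ofReal (Real.exp_pos _).le] at this
    rw [Real.exp_neg, inv_mul_eq_div, le_div_iff₀ (Real.exp_pos _), mul_comm]
    exact this
  have ha1 : a.real E1 ≤ γ := by
    apply solve
    have h1 := (h E1 hE1m).1
    have h2 := mul_le_mul_of_nonneg_left hv1 (Real.exp_pos η).le
    rw [← mul_assoc, ← Real.exp_add, ← sub_eq_add_neg] at h2
    linarith
  have hv1' : v.real E1 ≤ γ :=
    hv1.trans ((mul_le_of_le_one_left measureReal_nonneg hexp).trans ha1)
  have hγ0 : 0 ≤ γ := measureReal_nonneg.trans ha1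
  have hcover : (Set.univ : Set Z) ⊆ (r ⁻¹' ratioRange η' ∩ S) ∪ (E1 ∪ E2) := by
    intro y _
    by_cases hyS : y ∈ S
    · by_cases h1 : ENNReal.ofReal (Real.exp η') < r y
      · exact Or.inr (Or.inl (Or.inl h1))
      · by_cases h2 : r y < ENNReal.ofReal (Real.exp (-η'))
        · exact Or.inr (Or.inr ⟨h2, hyS⟩)
        · exact Or.inl ⟨⟨not_lt.1 h2, not_lt.1 h1⟩, hyS⟩
    · exact Or.inr (Or.inl (Or.inr hyS))
  have bound : ∀ m : Measure Z, IsProbabilityMeasure m → m.real E1 ≤ γ → m.real E2 ≤ γ →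
      1 ≤ m (r ⁻¹' ratioRange η' ∩ S) + ENNReal.ofReal (2 * γ) := by
    intro m _ h1 h2
    calc (1 : ℝ≥0∞) = m Set.univ := measure_univ.symm
      _ ≤ m (r ⁻¹' ratioRange η' ∩ S) + (m E1 + m E2) :=
        (measure_mono hcover).trans ((measure_union_le _ _).trans
          (by gcongr; exact measure_union_le _ _))
      _ ≤ _ := by
        gcongr
        rw [two_mul, ENNReal.ofReal_add hγ0 hγ0]
        gcongr
        · rw [← ofReal_measureReal]; exact ENNReal.ofReal_le_ofReal h1
        · rw [← ofReal_measureReal]; exact ENNReal.ofReal_le_ofReal h2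
  refine ⟨(bound v inferInstance hv1' hv2).trans ?_, (bound a inferInstance ha1 ha2').trans ?_⟩
  · gcongr
    exact Set.inter_subset_left
  · gcongr
    rw [key _ ((hr (measurableSet_ratioRange η')).inter hS),
      measure_mono_null Set.inter_subset_right hSs, zero_add]
    exact lintegral_mono_set Set.inter_subset_left

/-! ### Measurable choice of oracles -/

/-- On a countably generated measurable space there is a sequence of densities with values in
`[0, 1]` that approximates, uniformly over measurable sets, every such density with respect to
every finite measure. -/
theorem exists_seq_dense_density (Z : Type*) [MeasurableSpace Z]
    [MeasurableSpace.CountablyGenerated Z] :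
    ∃ g : ℕ → Z → ℝ≥0∞, (∀ n, Measurable (g n)) ∧ (∀ n y, g n y ≤ 1) ∧
      ∀ (μ : Measure Z) [IsFiniteMeasure μ] (f : Z → ℝ≥0∞), Measurable f → (∀ y, f y ≤ 1) →
        ∀ ε : ℝ, 0 < ε → ∃ n, ∀ O, MeasurableSet O →
          ∫⁻ y in O, f y ∂μ ≤ ∫⁻ y in O, g n y ∂μ + ENNReal.ofReal ε ∧
          ∫⁻ y in O, g n y ∂μ ≤ ∫⁻ y in O, f y ∂μ + ENNReal.ofReal ε := by
  -- A density with values in `[0, 1]` is the length of the sections of its subgraph. A countable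
  -- algebra generating the product σ-algebra approximates the subgraph in measure. The measure of
  -- the symmetric difference bounds the error on every `O` at once, because an integral over `O` is
  -- the measure of the part above `O`.
  set R : Set (Set (Z × ℝ)) := generateSetAlgebra (MeasurableSpace.countableGeneratingSet (Z × ℝ))
    with hR
  have hRalg : IsSetAlgebra R := isSetAlgebra_generateSetAlgebra
  have hRgen : (inferInstance : MeasurableSpace (Z × ℝ)) = MeasurableSpace.generateFrom R := by
    rw [hR, generateFrom_generateSetAlgebra_eq]
    exact (MeasurableSpace.generateFrom_countableGeneratingSet).symm
  have hRc : R.Countable :=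
    countable_generateSetAlgebra (MeasurableSpace.countable_countableGeneratingSet)
  obtain ⟨G, hG⟩ := hRc.exists_eq_range ⟨∅, hRalg.empty_mem⟩
  have hGm : ∀ n, MeasurableSet (G n) := by
    intro n
    have : G n ∈ R := hG ▸ Set.mem_range_self n
    have h := MeasurableSpace.measurableSet_generateFrom this
    rw [← hRgen] at h
    exact h
  set l : Measure ℝ := volume.restrict (Set.Icc 0 1) with hl
  have : IsProbabilityMeasure l := ⟨by simp [hl]⟩
  refine ⟨fun n y => l (Prod.mk y ⁻¹' G n), fun n => measurable_measure_prodMk_left (hGm n),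
    fun n y => prob_le_one, ?_⟩
  intro μ _ f hf hf1 ε hε
  set S : Set (Z × ℝ) := {p | ENNReal.ofReal p.2 ≤ f p.1} with hS
  have hSm : MeasurableSet S :=
    measurableSet_le (ENNReal.measurable_ofReal.comp measurable_snd) (hf.comp measurable_fst)
  have hSf : ∀ y, l (Prod.mk y ⁻¹' S) = f y := by
    intro y
    have hfin : f y ≠ ∞ := ne_top_of_le_ne_top ENNReal.one_ne_top (hf1 y)
    have : Prod.mk y ⁻¹' S = Set.Iic (f y).toReal := by
      ext t
      simp only [hS, Set.mem_preimage, Set.mem_ofPred_eq, Set.mem_Iic]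
      exact ENNReal.ofReal_le_iff_le_toReal hfin
    have h1 : (f y).toReal ≤ 1 := by
      have := ENNReal.toReal_mono ENNReal.one_ne_top (hf1 y)
      simpa using this
    rw [this, hl, Measure.restrict_apply measurableSet_Iic]
    have : Set.Iic (f y).toReal ∩ Set.Icc 0 1 = Set.Icc 0 (f y).toReal := by
      ext t
      simp only [Set.mem_inter_iff, Set.mem_Iic, Set.mem_Icc]
      constructor
      · rintro ⟨a, b, c⟩; exact ⟨b, a⟩
      · rintro ⟨a, b⟩; exact ⟨b, a, b.trans h1⟩
    rw [this, Real.volume_Icc, sub_zero, ENNReal.ofReal_toReal hfin]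
  have hdense := Measure.MeasureDense.of_generateFrom_isSetAlgebra_finite (μ.prod l) hRalg hRgen
  obtain ⟨t, htR, ht⟩ := hdense.approx S hSm (measure_ne_top _ _) ε hε
  rw [hG] at htR
  obtain ⟨n, rfl⟩ := htR
  have hint : ∀ (B : Set (Z × ℝ)), MeasurableSet B → ∀ O, MeasurableSet O →
      ∫⁻ y in O, l (Prod.mk y ⁻¹' B) ∂μ = (μ.prod l) (B ∩ Prod.fst ⁻¹' O) := by
    intro B hB O hO
    rw [Measure.prod_apply (hB.inter (measurable_fst hO)), ← lintegral_indicator hO]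
    refine lintegral_congr fun y => ?_
    by_cases hy : y ∈ O
    · rw [Set.indicator_of_mem hy]
      congr 1; ext u; simp [hy]
    · rw [Set.indicator_of_notMem hy]
      have : Prod.mk y ⁻¹' (B ∩ Prod.fst ⁻¹' O) = ∅ := by ext u; simp [hy]
      rw [this, measure_empty]
  refine ⟨n, fun O hO => ?_⟩
  have e : ∫⁻ y in O, f y ∂μ = (μ.prod l) (S ∩ Prod.fst ⁻¹' O) := by
    rw [← hint S hSm O hO]; simp_rw [hSf]
  rw [e, hint _ (hGm n) O hO]
  constructor
  · calc _ ≤ (μ.prod l) (G n ∩ Prod.fst ⁻¹' O ∪ S ∆ G n) := by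
          refine measure_mono ?_
          rintro p ⟨h1, h2⟩
          by_cases h : p ∈ G n
          · exact Or.inl ⟨h, h2⟩
          · exact Or.inr (Or.inl ⟨h1, h⟩)
      _ ≤ _ := (measure_union_le _ _).trans (by gcongr)
  · calc _ ≤ (μ.prod l) (S ∩ Prod.fst ⁻¹' O ∪ S ∆ G n) := by
          refine measure_mono ?_
          rintro p ⟨h1, h2⟩
          by_cases h : p ∈ S
          · exact Or.inl ⟨h, h2⟩
          · exact Or.inr (Or.inr ⟨h1, h⟩)
      _ ≤ _ := (measure_union_le _ _).trans (by gcongr)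

theorem nearlyPure_iff_of_ae_eq {Z : Type*} [MeasurableSpace Z] {η : ℝ} {δ : ℝ≥0∞}
    {a v : Measure Z} {r : Z → ℝ≥0∞} (hr : r =ᵐ[v] a.rnDeriv v) :
    NearlyPure η δ a v ↔ 1 ≤ v (r ⁻¹' ratioRange η) + δ ∧
      1 ≤ ∫⁻ y in r ⁻¹' ratioRange η, r y ∂v + δ := by
  have h : r ⁻¹' ratioRange η =ᵐ[v] a.rnDeriv v ⁻¹' ratioRange η := by
    filter_upwards [hr] with y hy
    refine propext ?_
    change r y ∈ ratioRange η ↔ a.rnDeriv v y ∈ ratioRange η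
    rw [hy]
  rw [NearlyPure, measure_congr h, Measure.restrict_congr_set h,
    lintegral_congr_ae (ae_restrict_of_ae hr)]

/-- For each `p` the derivative `(κ p).rnDeriv (ξ p)` is chosen separately. Its kernel version is
jointly measurable in `(p, y)`, which makes near purity a measurable condition on `p`. -/
theorem nearlyPure_iff_kernel_rnDeriv {α Z : Type*} [MeasurableSpace α] [MeasurableSpace Z]
    [MeasurableSpace.CountablyGenerated Z] (κ ξ : Kernel α Z) [IsFiniteKernel κ]
    [IsFiniteKernel ξ] (η : ℝ) (δ : ℝ≥0∞) (p : α) :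
    NearlyPure η δ (κ p) (ξ p) ↔ 1 ≤ ξ p (κ.rnDeriv ξ p ⁻¹' ratioRange η) + δ ∧
      1 ≤ ∫⁻ y in κ.rnDeriv ξ p ⁻¹' ratioRange η, κ.rnDeriv ξ p y ∂(ξ p) + δ :=
  nearlyPure_iff_of_ae_eq Kernel.rnDeriv_eq_rnDeriv_measure

theorem measurableSet_nearlyPure {α Z : Type*} [MeasurableSpace α] [MeasurableSpace Z]
    [MeasurableSpace.CountablyGenerated Z] (κ ξ : Kernel α Z) [IsFiniteKernel κ]
    [IsFiniteKernel ξ] (η : ℝ) (δ : ℝ≥0∞) : MeasurableSet {p | NearlyPure η δ (κ p) (ξ p)} := by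
  have hr := Kernel.measurable_rnDeriv κ ξ
  have hB : MeasurableSet {q : α × Z | κ.rnDeriv ξ q.1 q.2 ∈ ratioRange η} :=
    hr (measurableSet_ratioRange η)
  have m1 : Measurable fun p => ξ p (κ.rnDeriv ξ p ⁻¹' ratioRange η) :=
    Kernel.measurable_kernel_prodMk_left hB
  have m2 : Measurable fun p =>
      ∫⁻ y in κ.rnDeriv ξ p ⁻¹' ratioRange η, κ.rnDeriv ξ p y ∂(ξ p) := by
    have e2 : ∀ p, ∫⁻ y in κ.rnDeriv ξ p ⁻¹' ratioRange η, κ.rnDeriv ξ p y ∂(ξ p) =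
        ∫⁻ y, {q : α × Z | κ.rnDeriv ξ q.1 q.2 ∈ ratioRange η}.indicator
          (fun q => κ.rnDeriv ξ q.1 q.2) (p, y) ∂(ξ p) := fun p =>
      (lintegral_indicator (Kernel.measurable_rnDeriv_right κ ξ p (measurableSet_ratioRange η))
        _).symm
    simp_rw [e2]
    exact (hr.indicator hB).lintegral_kernel_prod_right'
  simp_rw [nearlyPure_iff_kernel_rnDeriv]
  exact (measurableSet_le measurable_const (m1.add_const _)).inter
    (measurableSet_le measurable_const (m2.add_const _))

/-- The Markov kernel with density proportional to `g` with respect to `κ` (and `κ` itself where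
`g` has integral zero). -/
theorem exists_kernel_normalized_density {T Z : Type*} [MeasurableSpace T] [MeasurableSpace Z]
    (κ : Kernel T Z) [IsMarkovKernel κ] {g : Z → ℝ≥0∞} (hg : Measurable g) (hg1 : ∀ y, g y ≤ 1) :
    ∃ V : Kernel T Z, IsMarkovKernel V ∧ ∀ z, ∫⁻ y, g y ∂(κ z) ≠ 0 →
      ∀ O, MeasurableSet O → V z O = (∫⁻ y in O, g y ∂(κ z)) / ∫⁻ y, g y ∂(κ z) := by
  classical
  have hm : Measurable fun z => ∫⁻ y, g y ∂(κ z) := hg.lintegral_kernel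
  have hle : ∀ z, ∫⁻ y, g y ∂(κ z) ≤ 1 := fun z =>
    (lintegral_mono hg1).trans (by simp)
  set h : T → Z → ℝ≥0∞ := fun z y =>
    if ∫⁻ y, g y ∂(κ z) = 0 then 1 else g y / ∫⁻ y, g y ∂(κ z) with hh
  have hhm : Measurable (Function.uncurry h) := by
    refine Measurable.ite ?_ measurable_const ?_
    · exact (hm.comp measurable_fst) (measurableSet_singleton 0)
    · exact (hg.comp measurable_snd).div (hm.comp measurable_fst)
  have happ : ∀ z, ∫⁻ y, g y ∂(κ z) ≠ 0 → ∀ O, MeasurableSet O →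
      (κ.withDensity h) z O = (∫⁻ y in O, g y ∂(κ z)) / ∫⁻ y, g y ∂(κ z) := by
    intro z hz O hO
    rw [Kernel.withDensity_apply' _ hhm]
    simp only [hh, if_neg hz, div_eq_mul_inv]
    rw [lintegral_mul_const _ hg]
  refine ⟨κ.withDensity h, ⟨fun z => ⟨?_⟩⟩, happ⟩
  by_cases hz : ∫⁻ y, g y ∂(κ z) = 0
  · rw [Kernel.withDensity_apply' _ hhm]
    simp [hh, hz]
  · rw [happ z hz _ MeasurableSet.univ, Measure.restrict_univ]
    exact ENNReal.div_self hz (ne_top_of_le_ne_top ENNReal.one_ne_top (hle z))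

/-- The average of the kernel `A` over its first argument. -/
theorem exists_average_kernel {D T Z : Type*} [MeasurableSpace D] [MeasurableSpace T]
    [MeasurableSpace Z] (P : Measure D) [IsProbabilityMeasure P] (A : Kernel (D × T) Z)
    [IsMarkovKernel A] : ∃ B : Kernel T Z, IsMarkovKernel B ∧
      ∀ z O, MeasurableSet O → B z O = ∫⁻ x, A (x, z) O ∂P := by
  refine ⟨A ∘ₖ ((Kernel.const T P) ×ₖ Kernel.id), inferInstance, fun z O hO => ?_⟩
  have hm := Kernel.measurable_coe A hO
  rw [Kernel.comp_apply' _ _ _ hO, Kernel.prod_apply, Kernel.const_apply, Kernel.id_apply,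
    lintegral_prod _ hm.aemeasurable]
  refine lintegral_congr fun x => ?_
  exact lintegral_dirac' _ (hm.comp measurable_prodMk_left)

/-- Selecting the first member of a sequence of Markov kernels that satisfies a measurable
condition gives a Markov kernel. -/
theorem exists_kernel_select {T Z : Type*} [MeasurableSpace T] [MeasurableSpace Z]
    (V : ℕ → Kernel T Z) (hV : ∀ n, IsMarkovKernel (V n)) (p : T → ℕ → Prop)
    (hp : ∀ z, ∃ n, p z n) (hm : ∀ n, MeasurableSet {z | p z n}) :
    ∃ U : Kernel T Z, IsMarkovKernel U ∧ ∀ z, ∃ n, p z n ∧ U z = V n z := by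
  classical
  have hN : Measurable fun z => Nat.find (hp z) := measurable_find hp hm
  let K : Kernel (T × ℕ) Z := ⟨fun q => V q.2 q.1,
    measurable_from_prod_countable_left fun n => (V n).measurable⟩
  have : IsMarkovKernel K := ⟨fun q => (hV q.2).isProbabilityMeasure q.1⟩
  refine ⟨K.comap (fun z => (z, Nat.find (hp z))) (measurable_id.prodMk hN), inferInstance,
    fun z => ⟨Nat.find (hp z), Nat.find_spec (hp z), rfl⟩⟩

/-- A typically stable kernel has its oracle distribution absolutely continuous, with bounded
density, with respect to the average output distribution. -/
theorem smul_le_of_typically {D Z : Type*} [MeasurableSpace D] [MeasurableSpace Z]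
    {P : Measure D} [IsProbabilityMeasure P] {A : Kernel D Z} [IsMarkovKernel A]
    {W B : Measure Z} [IsProbabilityMeasure W] {η ν : ℝ} (hν : ν ≤ 1)
    (hB : ∀ O, MeasurableSet O → B O = ∫⁻ x, A x O ∂P)
    (h : 1 - ν ≤ P.real {x | Indistinguishable η 0 (A x) W}) :
    ENNReal.ofReal ((1 - ν) * Real.exp (-η)) • W ≤ B := by
  refine Measure.le_intro fun O hO _ => ?_
  rw [hB O hO, Measure.smul_apply, smul_eq_mul,
    ENNReal.ofReal_mul (by linarith), mul_assoc, mul_comm]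
  refine le_trans ?_ (mul_meas_ge_le_lintegral (Kernel.measurable_coe A hO)
    (ENNReal.ofReal (Real.exp (-η)) * W O))
  gcongr
  rw [← ofReal_measureReal (μ := P)]
  refine ENNReal.ofReal_le_ofReal (h.trans (measureReal_mono ?_ (measure_ne_top _ _)))
  intro x hx
  have h1 := (hx O hO).2
  change ENNReal.ofReal (Real.exp (-η)) * W O ≤ A x O
  rw [← ofReal_measureReal (μ := W), ← ofReal_measureReal (μ := A x),
    ← ENNReal.ofReal_mul (Real.exp_pos _).le]
  refine ENNReal.ofReal_le_ofReal ?_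
  rw [Real.exp_neg, inv_mul_le_iff₀ (Real.exp_pos _)]
  linarith

/-- Controls the error of normalizing an approximate density. Since `a / m ≤ 1`, the error in the
denominator counts no more than the one in the numerator. -/
theorem abs_div_sub_div_le {a b m c ε : ℝ} (hc : 0 < c) (hm : 0 < m) (ha : 0 ≤ a) (ham : a ≤ m)
    (h1 : |a - b| ≤ ε) (h2 : |m - c| ≤ ε) : |a / m - b / c| ≤ 2 * ε / c := by
  have e : a / m - b / c = (a / m) * ((c - m) / c) + (a - b) / c := by field_simp; ring
  have h3 : a / m ≤ 1 := (div_le_one hm).2 ham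
  have h4 : 0 ≤ a / m := by positivity
  rw [e]
  refine (abs_add_le _ _).trans ?_
  rw [abs_mul, abs_of_nonneg h4, abs_div, abs_div, abs_of_pos hc, abs_sub_comm c m]
  have h5 : a / m * (|m - c| / c) ≤ ε / c := by
    calc a / m * (|m - c| / c) ≤ 1 * (|m - c| / c) := by gcongr
      _ ≤ ε / c := by rw [one_mul]; gcongr
  have h6 : |a - b| / c ≤ ε / c := by gcongr
  calc _ ≤ ε / c + ε / c := add_le_add h5 h6
    _ = 2 * ε / c := by ring

/-- A measurable choice of oracle distributions, at the price of a likelihood ratio that is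
bounded by a slightly larger constant, off a set of small measure. -/
theorem exists_measurable_oracle {D T Z : Type*} [MeasurableSpace D] [MeasurableSpace T]
    [MeasurableSpace Z] [MeasurableSpace.CountablyGenerated Z] (P : Measure D)
    [IsProbabilityMeasure P] (A : Kernel (D × T) Z) [IsMarkovKernel A] {η η' ν δ : ℝ}
    (hη : 0 ≤ η) (hη' : η < η') (hν : ν < 1) (hδ : 0 < δ)
    (h : ∀ z, ∃ W : ProbabilityMeasure Z,
      1 - ν ≤ P.real {x | Indistinguishable η 0 (A (x, z)) (W : Measure Z)}) :
    ∃ V : Kernel T Z, IsMarkovKernel V ∧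
      ∀ z, 1 - ν ≤ P.real {x | NearlyPure η' (ENNReal.ofReal δ) (A (x, z)) (V z)} := by
  obtain ⟨B, hBM, hB⟩ := exists_average_kernel P A
  obtain ⟨g, hgm, hg1, hg⟩ := exists_seq_dense_density Z
  choose V hVM hV using fun n => exists_kernel_normalized_density B (hgm n) (hg1 n)
  have hmeas : ∀ n, MeasurableSet
      {p : D × T | NearlyPure η' (ENNReal.ofReal δ) (A p) (V n p.2)} := fun n =>
    measurableSet_nearlyPure A ((V n).comap Prod.snd measurable_snd) η' (ENNReal.ofReal δ)
  have hmz : ∀ n, MeasurableSet {z : T |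
      1 - ν ≤ P.real {x | NearlyPure η' (ENNReal.ofReal δ) (A (x, z)) (V n z)}} := by
    intro n
    have : Measurable fun z => P.real {x | NearlyPure η' (ENNReal.ofReal δ) (A (x, z)) (V n z)} :=
      (measurable_measure_prodMk_right (hmeas n)).ennreal_toReal
    exact measurableSet_le measurable_const this
  have hex : ∀ z, ∃ n,
      1 - ν ≤ P.real {x | NearlyPure η' (ENNReal.ofReal δ) (A (x, z)) (V n z)} := by
    intro z
    obtain ⟨W, hW⟩ := h z
    -- The oracle is scaled by `c` so that it lies below the average output; its density is then at
    -- most one and falls under the approximation by `g`.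
    set c := (1 - ν) * Real.exp (-η) with hc
    have hc0 : 0 < c := mul_pos (by linarith) (Real.exp_pos _)
    have hle : ENNReal.ofReal c • (W : Measure Z) ≤ B z :=
      smul_le_of_typically (A := A.comap (fun x => (x, z)) measurable_prodMk_right) hν.le
        (hB z) hW
    set f₀ := (ENNReal.ofReal c • (W : Measure Z)).rnDeriv (B z) with hf₀
    have hf₀1 : f₀ ≤ᵐ[B z] 1 := Measure.rnDeriv_le_one_of_le hle
    have : IsFiniteMeasure (ENNReal.ofReal c • (W : Measure Z)) :=
      ⟨(hle _).trans_lt (measure_lt_top _ _)⟩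
    have hac : ENNReal.ofReal c • (W : Measure Z) ≪ B z := Measure.absolutelyContinuous_of_le hle
    have hf₀m : Measurable f₀ := Measure.measurable_rnDeriv _ _
    have hf : ∀ O, MeasurableSet O →
        ∫⁻ y in O, min (f₀ y) 1 ∂(B z) = ENNReal.ofReal c * (W : Measure Z) O := by
      intro O hO
      have h1 : ∫⁻ y in O, f₀ y ∂(B z) = ENNReal.ofReal c * (W : Measure Z) O := by
        rw [hf₀, Measure.setLIntegral_rnDeriv hac, Measure.smul_apply, smul_eq_mul]
      rw [← h1]
      refine lintegral_congr_ae (ae_restrict_of_ae ?_)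
      filter_upwards [hf₀1] with y hy
      exact min_eq_left hy
    -- accuracy of the approximation
    set ε₁ := δ * (1 - Real.exp (η - η')) / 2 with hε₁
    have hden : 0 < 1 - Real.exp (η - η') := by
      have : Real.exp (η - η') < 1 := Real.exp_lt_one_iff.2 (by linarith)
      linarith
    have hε₁0 : 0 < ε₁ := by positivity
    -- The first bound keeps the total mass of `g n` positive. The second makes the normalized
    -- measure `e^{-η} ε₁`-close to `W`, where `e^{-η}` offsets the factor `e^η` in
    -- indistinguishability.
    set ε := min (c / 2) (c * Real.exp (-η) * ε₁ / 2) with hε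
    have hε0 : 0 < ε := by
      have := Real.exp_pos (-η)
      exact lt_min (by positivity) (by positivity)
    obtain ⟨n, hn⟩ := hg (B z) (fun y => min (f₀ y) 1) (hf₀m.min measurable_const)
      (fun y => min_le_right _ _) ε hε0
    refine ⟨n, hW.trans (measureReal_mono (fun x hx => ?_) (measure_ne_top _ _))⟩
    have hfin : ∀ O, ∫⁻ y in O, g n y ∂(B z) ≠ ∞ := fun O =>
      ne_top_of_le_ne_top (b := B z O) (by finiteness)
        ((lintegral_mono (hg1 n)).trans (by simp))
    have habs : ∀ O, MeasurableSet O →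
        |(∫⁻ y in O, g n y ∂(B z)).toReal - c * (W : Measure Z).real O| ≤ ε := by
      intro O hO
      obtain ⟨h1, h2⟩ := hn O hO
      rw [hf O hO] at h1 h2
      have h1' := ENNReal.toReal_mono (by have := hfin O; finiteness) h1
      have h2' := ENNReal.toReal_mono (by finiteness) h2
      rw [ENNReal.toReal_add (hfin O) (by finiteness), ENNReal.toReal_mul,
        ENNReal.toReal_ofReal hc0.le, ENNReal.toReal_ofReal hε0.le] at h1'
      rw [ENNReal.toReal_add (by finiteness) (by finiteness), ENNReal.toReal_mul,
        ENNReal.toReal_ofReal hc0.le, ENNReal.toReal_ofReal hε0.le] at h2'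
      rw [abs_le]
      constructor <;> simp only [Measure.real] <;> linarith
    have huniv := habs Set.univ MeasurableSet.univ
    rw [probReal_univ, mul_one] at huniv
    have hm0 : 0 < (∫⁻ y in Set.univ, g n y ∂(B z)).toReal := by
      have h1 := (abs_le.1 huniv).1
      have h2 : ε ≤ c / 2 := min_le_left _ _
      linarith
    have hVapp : ∀ O, MeasurableSet O → (V n z).real O =
        (∫⁻ y in O, g n y ∂(B z)).toReal / (∫⁻ y in Set.univ, g n y ∂(B z)).toReal := by
      intro O hO
      rw [Measure.real, hV n z _ O hO, ENNReal.toReal_div, Measure.restrict_univ]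
      intro h0
      rw [Measure.restrict_univ, h0] at hm0
      simp at hm0
    have hclose : ∀ O, MeasurableSet O →
        |(V n z).real O - (W : Measure Z).real O| ≤ Real.exp (-η) * ε₁ := by
      intro O hO
      have h1 := abs_div_sub_div_le hc0 hm0 ENNReal.toReal_nonneg
        (ENNReal.toReal_mono (hfin _) (lintegral_mono_set (Set.subset_univ O))) (habs O hO) huniv
      rw [← hVapp O hO, mul_div_cancel_left₀ _ hc0.ne'] at h1
      refine h1.trans ?_
      rw [div_le_iff₀ hc0]
      have h2 : ε ≤ c * Real.exp (-η) * ε₁ / 2 := min_le_right _ _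
      linarith
    have hind : Indistinguishable η ε₁ (A (x, z)) (V n z) := by
      intro O hO
      obtain ⟨h1, h2⟩ := hx O hO
      obtain ⟨h3, h4⟩ := abs_le.1 (hclose O hO)
      have he : Real.exp η * Real.exp (-η) = 1 := by rw [← Real.exp_add]; simp
      have he1 : Real.exp (-η) ≤ 1 := Real.exp_le_one_iff.2 (by linarith)
      constructor
      · have h5 := mul_le_mul_of_nonneg_left h3 (Real.exp_pos η).le
        have h6 : Real.exp η * (-(Real.exp (-η) * ε₁)) = -ε₁ := by
          linear_combination (-ε₁) * he
        rw [h6] at h5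
        linarith
      · have h5 : Real.exp (-η) * ε₁ ≤ ε₁ := mul_le_of_le_one_left hε₁0.le he1
        linarith
    have := hind.nearlyPure hη hη'
    have e : 2 * (ε₁ / (1 - Real.exp (η - η'))) = δ := by rw [hε₁]; field_simp
    rw [e] at this
    exact this
  obtain ⟨U, hUM, hU⟩ := exists_kernel_select V hVM _ hex hmz
  refine ⟨U, hUM, fun z => ?_⟩
  obtain ⟨n, hn, hUn⟩ := hU z
  rw [hUn]
  exact hn

/-! ### Truncated densities of a single step -/

/-- `r ^ (-l)`, with the convention that the value at `0` is `0`. -/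
noncomputable def negPow (l : ℝ) (r : ℝ≥0∞) : ℝ≥0∞ := ({0}ᶜ : Set ℝ≥0∞).indicator (· ^ (-l)) r

theorem negPow_zero (l : ℝ) : negPow l 0 = 0 := by simp [negPow]

theorem negPow_of_ne_zero (l : ℝ) {r : ℝ≥0∞} (hr : r ≠ 0) : negPow l r = r ^ (-l) := by
  simp [negPow, hr]

theorem measurable_negPow (l : ℝ) : Measurable (negPow l) :=
  Measurable.indicator (by fun_prop) (measurableSet_singleton 0).compl

theorem negPow_mul (l : ℝ) (a b : ℝ≥0∞) : negPow l (a * b) = negPow l a * negPow l b := by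
  by_cases ha : a = 0
  · simp [ha, negPow_zero]
  by_cases hb : b = 0
  · simp [hb, negPow_zero]
  rw [negPow_of_ne_zero l ha, negPow_of_ne_zero l hb, negPow_of_ne_zero l (mul_ne_zero ha hb),
    ENNReal.mul_rpow_of_ne_zero ha hb]

theorem ne_zero_of_mem_ratioRange {η : ℝ} {r : ℝ≥0∞} (hr : r ∈ ratioRange η) : r ≠ 0 :=
  (lt_of_lt_of_le (ENNReal.ofReal_pos.2 (Real.exp_pos _)) hr.1).ne'

/-- `q` is the density with respect to the oracle `V` of a part of the algorithm `A`, with values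
in `{0} ∪ [e^{-η}, e^η]`; on average over the data the part left out has mass at most `ν`, both
for `A` and for `V`. The parameter `δ` enters the moment bounds. -/
structure IsTruncatedDensity {D T Z : Type*} [MeasurableSpace D] [MeasurableSpace T]
    [MeasurableSpace Z] (P : Measure D) (A : Kernel (D × T) Z) (V : Kernel T Z)
    (q : (D × T) × Z → ℝ≥0∞) (η δ ν : ℝ) : Prop where
  measurable : Measurable q
  le : ∀ x z O, MeasurableSet O → ∫⁻ y in O, q ((x, z), y) ∂(V z) ≤ A (x, z) O
  range : ∀ w, q w = 0 ∨ q w ∈ ratioRange η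
  mass : ∀ z, 1 ≤ ∫⁻ x, ∫⁻ y, q ((x, z), y) ∂(V z) ∂P + ENNReal.ofReal ν
  null : ∀ z, ∫⁻ x, V z {y | q ((x, z), y) = 0} ∂P ≤ ENNReal.ofReal ν
  moment : ∀ l : ℝ, 0 ≤ l → ∀ x z,
    ∫⁻ y, q ((x, z), y) ^ (l + 1) ∂(V z) ≤ ENNReal.ofReal (momentBound η l δ)
  moment_neg : ∀ l : ℝ, 0 ≤ l → ∀ x z,
    ∫⁻ y, negPow l (q ((x, z), y)) ∂(V z) ≤ ENNReal.ofReal (momentBound η l δ)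

/-- `q` is the kernel derivative, set to zero outside the pure range and for all `(x, z)` that are
not nearly pure. Discarding bad data entirely makes the moment bounds hold for every `x` and `z`.
The price is paid only on average over the data: `ν` for bad data and `δ` for impure outputs. -/
theorem exists_isTruncatedDensity {D T Z : Type*} [MeasurableSpace D] [MeasurableSpace T]
    [MeasurableSpace Z] [MeasurableSpace.CountablyGenerated Z] (P : Measure D)
    [IsProbabilityMeasure P] (A : Kernel (D × T) Z) [IsMarkovKernel A] (V : Kernel T Z)
    [IsMarkovKernel V] {η ν δ : ℝ} (hη : 0 < η) (hν : 0 ≤ ν) (hδ : 0 ≤ δ)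
    (h : ∀ z, 1 - ν ≤ P.real {x | NearlyPure η (ENNReal.ofReal δ) (A (x, z)) (V z)}) :
    ∃ q, IsTruncatedDensity P A V q η δ (ν + δ) := by
  set ξ : Kernel (D × T) Z := V.comap Prod.snd measurable_snd with hξ
  have hξa : ∀ x z, ξ (x, z) = V z := fun x z => rfl
  set H : Set (D × T) := {p | NearlyPure η (ENNReal.ofReal δ) (A p) (ξ p)} with hH
  have hHm : MeasurableSet H := measurableSet_nearlyPure A ξ η _
  set B : Set ((D × T) × Z) := {w | w.1 ∈ H ∧ A.rnDeriv ξ w.1 w.2 ∈ ratioRange η} with hB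
  have hr := Kernel.measurable_rnDeriv A ξ
  have hBm : MeasurableSet B :=
    (measurable_fst hHm).inter (hr (measurableSet_ratioRange η))
  set q : (D × T) × Z → ℝ≥0∞ := B.indicator fun w => A.rnDeriv ξ w.1 w.2 with hq
  have hqm : Measurable q := hr.indicator hBm
  have hrm : ∀ p, Measurable (A.rnDeriv ξ p) := Kernel.measurable_rnDeriv_right A ξ
  have hq1 : ∀ p ∈ H, ∀ y, q (p, y) =
      (A.rnDeriv ξ p ⁻¹' ratioRange η).indicator (A.rnDeriv ξ p) y := by
    intro p hp y
    by_cases hy : A.rnDeriv ξ p y ∈ ratioRange η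
    · rw [hq, Set.indicator_of_mem (show (p, y) ∈ B from ⟨hp, hy⟩),
        Set.indicator_of_mem (show y ∈ _ from hy)]
    · rw [hq, Set.indicator_of_notMem (show (p, y) ∉ B from fun h => hy h.2),
        Set.indicator_of_notMem (show y ∉ _ from hy)]
  have hq0 : ∀ p ∉ H, ∀ y, q (p, y) = 0 := fun p hp y =>
    Set.indicator_of_notMem (show (p, y) ∉ B from fun h => hp h.1) _
  have hsm : ∀ p, MeasurableSet (A.rnDeriv ξ p ⁻¹' ratioRange η) := fun p =>
    hrm p (measurableSet_ratioRange η)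
  have hqf : ∀ f : ℝ≥0∞ → ℝ≥0∞, f 0 = 0 → ∀ p ∈ H, ∫⁻ y, f (q (p, y)) ∂(ξ p) =
      ∫⁻ y in A.rnDeriv ξ p ⁻¹' ratioRange η, f (A.rnDeriv ξ p y) ∂(ξ p) := by
    intro f hf p hp
    rw [← lintegral_indicator (hsm p)]
    refine lintegral_congr fun y => ?_
    rw [hq1 p hp y]
    by_cases hy : A.rnDeriv ξ p y ∈ ratioRange η
    · rw [Set.indicator_of_mem (show y ∈ _ from hy), Set.indicator_of_mem (show y ∈ _ from hy)]
    · rw [Set.indicator_of_notMem (show y ∉ _ from hy),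
        Set.indicator_of_notMem (show y ∉ _ from hy), hf]
  have hP : ∀ z, 1 ≤ P {x | (x, z) ∈ H} + ENNReal.ofReal ν := by
    intro z
    have h1 := h z
    rw [← ofReal_measureReal, ← ENNReal.ofReal_add measureReal_nonneg hν, ← ENNReal.ofReal_one]
    refine ENNReal.ofReal_le_ofReal ?_
    change 1 - ν ≤ P.real {x | (x, z) ∈ H} at h1
    linarith
  have hHz : ∀ z, MeasurableSet {x | (x, z) ∈ H} := fun z => measurable_prodMk_right hHm
  have hle : ∀ p O, MeasurableSet O → ∫⁻ y in O, A.rnDeriv ξ p y ∂(ξ p) ≤ A p O :=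
    fun p O hO => Kernel.setLIntegral_rnDeriv_le hO
  have hmb : ∀ l : ℝ, 0 ≤ l → 0 ≤ momentBound η l δ := by
    intro l hl
    have : 0 ≤ Real.sinh (l * η) / Real.sinh η := div_nonneg
      (Real.sinh_nonneg_iff.2 (by positivity)) (Real.sinh_nonneg_iff.2 hη.le)
    unfold momentBound
    positivity
  refine ⟨q, hqm, ?_, ?_, ?_, ?_, ?_, ?_⟩
  · intro x z O hO
    refine le_trans (lintegral_mono fun y => ?_) (hle (x, z) O hO)
    exact Set.indicator_le_self B (fun w => A.rnDeriv ξ w.1 w.2) ((x, z), y)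
  · intro w
    by_cases hw : w ∈ B
    · right
      rw [hq, Set.indicator_of_mem hw]
      exact hw.2
    · exact Or.inl (Set.indicator_of_notMem hw _)
  · intro z
    have h1 : ∀ x, {x | (x, z) ∈ H}.indicator 1 x ≤
        ∫⁻ y, q ((x, z), y) ∂(V z) + ENNReal.ofReal δ := by
      intro x
      by_cases hx : (x, z) ∈ H
      · rw [Set.indicator_of_mem (show x ∈ _ from hx), Pi.one_apply, ← hξa x z,
          hqf (fun r => r) rfl _ hx]
        exact ((nearlyPure_iff_kernel_rnDeriv A ξ η _ (x, z)).1 hx).2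
      · rw [Set.indicator_of_notMem (show x ∉ _ from hx)]
        exact zero_le
    rw [add_comm ν δ, ENNReal.ofReal_add hδ hν, ← add_assoc]
    refine (hP z).trans ?_
    gcongr
    rw [← lintegral_indicator_one (hHz z)]
    refine (lintegral_mono h1).trans ?_
    rw [lintegral_add_right _ measurable_const, lintegral_const, measure_univ, mul_one]
  · intro z
    have h1 : ∀ x, V z {y | q ((x, z), y) = 0} ≤
        {x | (x, z) ∈ H}ᶜ.indicator 1 x + ENNReal.ofReal δ := by
      intro x
      by_cases hx : (x, z) ∈ H
      · have h2 := ((nearlyPure_iff_kernel_rnDeriv A ξ η _ (x, z)).1 hx).1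
        have h3 : {y | q ((x, z), y) = 0} ⊆ (A.rnDeriv ξ (x, z) ⁻¹' ratioRange η)ᶜ := by
          intro y hy hy'
          have hy0 : q ((x, z), y) = 0 := hy
          rw [hq1 _ hx, Set.indicator_of_mem hy'] at hy0
          exact ne_zero_of_mem_ratioRange hy' hy0
        refine (measure_mono h3).trans (le_trans ?_ le_add_self)
        rw [prob_compl_eq_one_sub (hsm (x, z))]
        exact tsub_le_iff_left.2 h2
      · rw [Set.indicator_of_mem (show x ∈ {x | (x, z) ∈ H}ᶜ from hx)]
        exact prob_le_one.trans le_self_add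
    refine (lintegral_mono h1).trans ?_
    rw [lintegral_add_right _ measurable_const, lintegral_const, measure_univ, mul_one,
      lintegral_indicator_one (hHz z).compl, ENNReal.ofReal_add hν hδ]
    gcongr
    rw [prob_compl_eq_one_sub (hHz z)]
    exact tsub_le_iff_left.2 (hP z)
  · intro l hl x z
    by_cases hx : (x, z) ∈ H
    · rw [← hξa x z, hqf (fun r => r ^ (l + 1)) (ENNReal.zero_rpow_of_pos (by linarith)) _ hx]
      exact setLIntegral_rpow_le_momentBound (hrm _) hη hl hδ
        ((hle _ _ (hsm _)).trans prob_le_one)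
        ((nearlyPure_iff_kernel_rnDeriv A ξ η _ (x, z)).1 hx).1
    · simp_rw [hq0 _ hx, ENNReal.zero_rpow_of_pos (show (0 : ℝ) < l + 1 by linarith)]
      simp
  · intro l hl x z
    by_cases hx : (x, z) ∈ H
    · rw [← hξa x z, hqf (negPow l) (negPow_zero l) _ hx]
      refine le_trans (setLIntegral_mono' (hsm _) fun y hy => ?_)
        (setLIntegral_rpow_neg_le_momentBound (hrm _) hη hl hδ
        ((nearlyPure_iff_kernel_rnDeriv A ξ η _ (x, z)).1 hx).2)
      rw [negPow_of_ne_zero l (ne_zero_of_mem_ratioRange hy)]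
    · simp_rw [hq0 _ hx, negPow_zero]
      simp

/-! ### Densities of transcripts -/

theorem appendOutput_init (Z : ℕ → Type*) (j : ℕ) (p : (∀ i : Fin j, Z i) × Z j) :
    (Fin.init (α := fun i : Fin (j + 1) => Z i) (appendOutput Z j p) : ∀ i : Fin j, Z i) = p.1 :=
  Fin.init_snoc (α := fun i : Fin (j + 1) => Z i) _ _

theorem appendOutput_last (Z : ℕ → Type*) (j : ℕ) (p : (∀ i : Fin j, Z i) × Z j) :
    appendOutput Z j p (Fin.last j) = p.2 :=
  Fin.snoc_last (α := fun i : Fin (j + 1) => Z i) _ _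

/-- The product of the densities `q 0, …, q (k - 1)` along a transcript. -/
noncomputable def transcriptDensity {D : Type*} {Z : ℕ → Type*}
    (q : ∀ i : ℕ, (D × (∀ j : Fin i, Z j)) × Z i → ℝ≥0∞) :
    ∀ k : ℕ, D × (∀ i : Fin k, Z i) → ℝ≥0∞
  | 0 => fun _ => 1
  | k + 1 => fun p =>
    transcriptDensity q k (p.1, Fin.init (α := fun i : Fin (k + 1) => Z i) p.2) *
      q k ((p.1, Fin.init (α := fun i : Fin (k + 1) => Z i) p.2), p.2 (Fin.last k))

theorem transcriptDensity_appendOutput {D : Type*} {Z : ℕ → Type*}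
    (q : ∀ i : ℕ, (D × (∀ j : Fin i, Z j)) × Z i → ℝ≥0∞)
    (k : ℕ) (x : D) (z : ∀ i : Fin k, Z i) (y : Z k) :
    transcriptDensity q (k + 1) (x, appendOutput Z k (z, y)) =
      transcriptDensity q k (x, z) * q k ((x, z), y) := by
  rw [transcriptDensity]
  dsimp only
  rw [appendOutput_init, appendOutput_last]

section Composition

variable {D : Type*} [MeasurableSpace D] {Z : ℕ → Type*} [∀ i, MeasurableSpace (Z i)]

theorem lintegral_map_appendOutput {j : ℕ} (μ : Measure (∀ i : Fin j, Z i)) [SFinite μ]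
    (κ : Kernel (∀ i : Fin j, Z i) (Z j)) [IsSFiniteKernel κ]
    {f : (∀ i : Fin (j + 1), Z i) → ℝ≥0∞} (hf : Measurable f) :
    ∫⁻ w, f w ∂((μ ⊗ₘ κ).map (appendOutput Z j)) =
      ∫⁻ z, ∫⁻ y, f (appendOutput Z j (z, y)) ∂(κ z) ∂μ := by
  have hm := measurable_appendOutput Z j
  rw [lintegral_map hf hm, Measure.lintegral_compProd
    (show Measurable fun p => f (appendOutput Z j p) from hf.comp hm)]

theorem adaptiveComposition_succ_apply (𝒜 : ∀ i : ℕ, Kernel (D × (∀ j : Fin i, Z j)) (Z i))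
    [∀ i, IsMarkovKernel (𝒜 i)] (k : ℕ) (x : D) :
    adaptiveComposition 𝒜 (k + 1) x =
      (adaptiveComposition 𝒜 k x ⊗ₘ (𝒜 k).sectR x).map (appendOutput Z k) := by
  rw [adaptiveComposition, Kernel.map_apply _ (measurable_appendOutput Z k),
    Kernel.compProd_apply_eq_compProd_sectR]

/-- The composition of oracles `V i`, which do not see the data. -/
noncomputable def oracleComposition (V : ∀ i : ℕ, Kernel (∀ j : Fin i, Z j) (Z i)) :
    ∀ k : ℕ, Measure (∀ i : Fin k, Z i)
  | 0 => Measure.dirac fun i => i.elim0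
  | k + 1 => (oracleComposition V k ⊗ₘ V k).map (appendOutput Z k)

instance isProbabilityMeasure_oracleComposition (V : ∀ i : ℕ, Kernel (∀ j : Fin i, Z j) (Z i))
    [∀ i, IsMarkovKernel (V i)] (k : ℕ) : IsProbabilityMeasure (oracleComposition V k) := by
  induction k with
  | zero => unfold oracleComposition; infer_instance
  | succ k ih =>
    unfold oracleComposition
    exact Measure.isProbabilityMeasure_map (measurable_appendOutput Z k).aemeasurable

variable {q : ∀ i : ℕ, (D × (∀ j : Fin i, Z j)) × Z i → ℝ≥0∞}

theorem measurable_transcriptDensity {k : ℕ} (hq : ∀ i < k, Measurable (q i)) :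
    Measurable (transcriptDensity q k) := by
  induction k with
  | zero => exact measurable_const
  | succ k ih =>
    have hi : Measurable fun w : ∀ i : Fin (k + 1), Z i =>
        (Fin.init (α := fun i : Fin (k + 1) => Z i) w : ∀ i : Fin k, Z i) :=
      measurable_pi_lambda _ fun i => measurable_pi_apply (Fin.castSucc i)
    have hp : Measurable fun p : D × (∀ i : Fin (k + 1), Z i) =>
        ((p.1, Fin.init (α := fun i : Fin (k + 1) => Z i) p.2) : D × ∀ i : Fin k, Z i) :=
      measurable_fst.prodMk (hi.comp measurable_snd)
    have hl : Measurable fun p : D × (∀ i : Fin (k + 1), Z i) => (p.2 (Fin.last k) : Z k) :=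
      (measurable_pi_apply (Fin.last k)).comp measurable_snd
    exact ((ih fun i hi => hq i (hi.trans k.lt_succ_self)).comp hp).mul
      ((hq k k.lt_succ_self).comp (hp.prodMk hl))

variable {P : Measure D} {𝒜 : ∀ i : ℕ, Kernel (D × (∀ j : Fin i, Z j)) (Z i)}
  {V : ∀ i : ℕ, Kernel (∀ j : Fin i, Z j) (Z i)} [∀ i, IsMarkovKernel (V i)] {η δ ν : ℝ}

/-- The measure with density `ρ_k(x, ·)` lies below the true law, since each `q i` describes a part
of `𝒜 i`. With a general test function the induction closes: integrating out the last output gives a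
test function for the shorter transcript. -/
theorem lintegral_mul_transcriptDensity_le [∀ i, IsMarkovKernel (𝒜 i)] {k : ℕ}
    (h : ∀ i < k, IsTruncatedDensity P (𝒜 i) (V i) (q i) η δ ν) (x : D)
    {f : (∀ i : Fin k, Z i) → ℝ≥0∞} (hf : Measurable f) :
    ∫⁻ z, f z * transcriptDensity q k (x, z) ∂(oracleComposition V k) ≤
      ∫⁻ z, f z ∂(adaptiveComposition 𝒜 k x) := by
  induction k with
  | zero => simp [transcriptDensity, oracleComposition, adaptiveComposition]
  | succ k ih =>
    have hk := h k k.lt_succ_self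
    have h' : ∀ i < k, IsTruncatedDensity P (𝒜 i) (V i) (q i) η δ ν := fun i hi =>
      h i (hi.trans k.lt_succ_self)
    have hρ : Measurable (transcriptDensity q (k + 1)) :=
      measurable_transcriptDensity fun i hi => (h i hi).measurable
    have hρx : Measurable fun w => transcriptDensity q (k + 1) (x, w) :=
      hρ.comp measurable_prodMk_left
    have hfa : Measurable fun p : (∀ i : Fin k, Z i) × Z k => f (appendOutput Z k p) :=
      hf.comp (measurable_appendOutput Z k)
    rw [adaptiveComposition_succ_apply, oracleComposition,
      lintegral_map_appendOutput _ _
        (show Measurable fun w => f w * transcriptDensity q (k + 1) (x, w) from hf.mul hρx),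
      lintegral_map_appendOutput _ _ hf]
    refine le_trans (lintegral_mono fun z => ?_) (ih h' (f := fun z =>
      ∫⁻ y, f (appendOutput Z k (z, y)) ∂((𝒜 k).sectR x z)) hfa.lintegral_kernel_prod_right')
    have hqm : Measurable fun y => q k ((x, z), y) := hk.measurable.comp measurable_prodMk_left
    have hfm : Measurable fun y => f (appendOutput Z k (z, y)) := hfa.comp measurable_prodMk_left
    have hle : (V k z).withDensity (fun y => q k ((x, z), y)) ≤ 𝒜 k (x, z) :=
      Measure.le_intro fun O hO _ => by rw [withDensity_apply _ hO]; exact hk.le x z O hO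
    simp_rw [transcriptDensity_appendOutput]
    calc ∫⁻ y, f (appendOutput Z k (z, y)) *
          (transcriptDensity q k (x, z) * q k ((x, z), y)) ∂(V k z)
        = (∫⁻ y, f (appendOutput Z k (z, y))
            ∂((V k z).withDensity (fun y => q k ((x, z), y)))) * transcriptDensity q k (x, z) := by
          rw [lintegral_withDensity_eq_lintegral_mul _ hqm hfm,
            ← lintegral_mul_const _ (hqm.mul hfm)]
          refine lintegral_congr fun y => ?_
          simp only [Pi.mul_apply]
          ring
      _ ≤ _ := mul_le_mul_left (lintegral_mono' hle le_rfl) _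

/-- The bound `c` is uniform in the past, so the last factor can be integrated out first. Allowing
any multiplicative `φ` covers both `r ^ (l + 1)` and `negPow l`. -/
theorem lintegral_multiplicative_transcriptDensity_le {k : ℕ} (hq : ∀ i < k, Measurable (q i))
    {φ : ℝ≥0∞ → ℝ≥0∞} (hφ : Measurable φ) (hφ1 : φ 1 = 1)
    (hφm : ∀ a b, φ (a * b) = φ a * φ b) {c : ℝ≥0∞} (x : D)
    (h : ∀ i < k, ∀ z, ∫⁻ y, φ (q i ((x, z), y)) ∂(V i z) ≤ c) :
    ∫⁻ z, φ (transcriptDensity q k (x, z)) ∂(oracleComposition V k) ≤ c ^ k := by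
  induction k with
  | zero => simp [transcriptDensity, hφ1, oracleComposition]
  | succ k ih =>
    have hρ : Measurable (transcriptDensity q (k + 1)) := measurable_transcriptDensity hq
    rw [oracleComposition, lintegral_map_appendOutput _ _
      (show Measurable fun w => φ (transcriptDensity q (k + 1) (x, w)) from
        hφ.comp (hρ.comp measurable_prodMk_left))]
    simp_rw [transcriptDensity_appendOutput, hφm]
    have hρ' : Measurable (transcriptDensity q k) :=
      measurable_transcriptDensity fun i hi => hq i (hi.trans k.lt_succ_self)
    calc ∫⁻ z, ∫⁻ y, φ (transcriptDensity q k (x, z)) * φ (q k ((x, z), y)) ∂(V k z)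
          ∂(oracleComposition V k)
        ≤ ∫⁻ z, φ (transcriptDensity q k (x, z)) * c ∂(oracleComposition V k) := by
          refine lintegral_mono fun z => ?_
          dsimp only
          rw [lintegral_const_mul _ (show Measurable fun y => φ (q k ((x, z), y)) from
            hφ.comp ((hq k k.lt_succ_self).comp measurable_prodMk_left))]
          gcongr
          exact h k k.lt_succ_self z
      _ = (∫⁻ z, φ (transcriptDensity q k (x, z)) ∂(oracleComposition V k)) * c :=
          lintegral_mul_const _ (hφ.comp (hρ'.comp measurable_prodMk_left))
      _ ≤ c ^ (k + 1) := by
          rw [pow_succ]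
          gcongr
          exact ih (fun i hi => hq i (hi.trans k.lt_succ_self))
            fun i hi => h i (hi.trans k.lt_succ_self)

/-- A product vanishes only if a factor does, so a union bound over the steps applies. The
transcript is drawn from the oracles, hence independently of the data, and each step costs `ν` with
no exponential factor. -/
theorem lintegral_transcriptDensity_eq_zero_le [IsProbabilityMeasure P] {k : ℕ}
    (h : ∀ i < k, IsTruncatedDensity P (𝒜 i) (V i) (q i) η δ ν) :
    ∫⁻ x, oracleComposition V k {z | transcriptDensity q k (x, z) = 0} ∂P ≤
      k * ENNReal.ofReal ν := by
  induction k with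
  | zero => simp [transcriptDensity]
  | succ k ih =>
    have hk := h k k.lt_succ_self
    have h' : ∀ i < k, IsTruncatedDensity P (𝒜 i) (V i) (q i) η δ ν := fun i hi =>
      h i (hi.trans k.lt_succ_self)
    have hρ : Measurable (transcriptDensity q (k + 1)) :=
      measurable_transcriptDensity fun i hi => (h i hi).measurable
    have hρ' : Measurable (transcriptDensity q k) :=
      measurable_transcriptDensity fun i hi => (h' i hi).measurable
    have hnull : MeasurableSet {w | transcriptDensity q (k + 1) w = 0} :=
      hρ (measurableSet_singleton 0)
    have hnull' : MeasurableSet {w | transcriptDensity q k w = 0} :=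
      hρ' (measurableSet_singleton 0)
    have hqnull : MeasurableSet {w | q k w = 0} := hk.measurable (measurableSet_singleton 0)
    have hqm : Measurable fun p : D × (∀ i : Fin k, Z i) => V k p.2 {y | q k (p, y) = 0} :=
      Kernel.measurable_kernel_prodMk_left (κ := (V k).comap Prod.snd measurable_snd) hqnull
    have hstep : ∀ x, oracleComposition V (k + 1) {z | transcriptDensity q (k + 1) (x, z) = 0} ≤
        oracleComposition V k {z | transcriptDensity q k (x, z) = 0} +
          ∫⁻ z, V k z {y | q k ((x, z), y) = 0} ∂(oracleComposition V k) := by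
      intro x
      have hx : MeasurableSet {z | transcriptDensity q (k + 1) (x, z) = 0} :=
        measurable_prodMk_left hnull
      have hx' : MeasurableSet {z | transcriptDensity q k (x, z) = 0} :=
        measurable_prodMk_left hnull'
      rw [← lintegral_indicator_one hx, ← lintegral_indicator_one hx', oracleComposition,
        lintegral_map_appendOutput _ _ (measurable_one.indicator hx),
        ← lintegral_add_left (measurable_one.indicator hx')]
      refine lintegral_mono fun z => ?_
      have hy : MeasurableSet {y | q k ((x, z), y) = 0} := measurable_prodMk_left hqnull
      rw [← lintegral_indicator_one hy]
      dsimp only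
      by_cases hz : transcriptDensity q k (x, z) = 0
      · rw [Set.indicator_of_mem (show z ∈ _ from hz)]
        have h1 : ∫⁻ y, {z | transcriptDensity q (k + 1) (x, z) = 0}.indicator
            (1 : (∀ i : Fin (k + 1), Z i) → ℝ≥0∞) (appendOutput Z k (z, y)) ∂(V k z) ≤ ∫⁻ _, 1 ∂(V k z) :=
          lintegral_mono fun y => Set.indicator_le_self' (fun _ _ => zero_le) _
        rw [lintegral_one, measure_univ] at h1
        exact h1.trans le_self_add
      · refine le_trans (lintegral_mono fun y => ?_) le_add_self
        by_cases hy0 : q k ((x, z), y) = 0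
        · rw [Set.indicator_of_mem (show y ∈ {y | q k ((x, z), y) = 0} from hy0)]
          exact Set.indicator_le_self' (fun _ _ => zero_le) _
        · rw [Set.indicator_of_notMem]
          · exact zero_le
          · intro hw
            have hw' : transcriptDensity q (k + 1) (x, appendOutput Z k (z, y)) = 0 := hw
            rw [transcriptDensity_appendOutput] at hw'
            exact mul_ne_zero hz hy0 hw'
    calc _ ≤ ∫⁻ x, (oracleComposition V k {z | transcriptDensity q k (x, z) = 0} +
          ∫⁻ z, V k z {y | q k ((x, z), y) = 0} ∂(oracleComposition V k)) ∂P :=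
          lintegral_mono hstep
      _ = ∫⁻ x, oracleComposition V k {z | transcriptDensity q k (x, z) = 0} ∂P +
          ∫⁻ z, ∫⁻ x, V k z {y | q k ((x, z), y) = 0} ∂P ∂(oracleComposition V k) := by
          rw [lintegral_add_left (show Measurable fun x =>
              oracleComposition V k {z | transcriptDensity q k (x, z) = 0} from
                measurable_measure_prodMk_left hnull'),
            lintegral_lintegral_swap (f := fun x z => V k z {y | q k ((x, z), y) = 0})
              hqm.aemeasurable]
      _ ≤ k * ENNReal.ofReal ν + ENNReal.ofReal ν := by
          refine add_le_add (ih h') ((lintegral_mono hk.null).trans ?_)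
          simp
      _ = _ := by push_cast; ring

/-- The change of measure at the heart of the argument. Step `t` loses the mass `∫ ρ_t(x, z) e(x,
z)`, where `e` is the mass missed by `q t`. Where `ρ_t ≤ E t`, replacing `ρ_t` by `E t` leaves a law
of `z` independent of `x`, and averaging over `x` first gives `E t * ν`. Elsewhere `e ≤ 1`, and the
tail `τ t` suffices. -/
theorem one_le_lintegral_transcriptDensity_add [IsProbabilityMeasure P]
    [∀ i, IsMarkovKernel (𝒜 i)] {k : ℕ}
    (h : ∀ i < k, IsTruncatedDensity P (𝒜 i) (V i) (q i) η δ ν) {E τ : ℕ → ℝ≥0∞}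
    (hE : ∀ t < k, ∀ x, ∫⁻ z in {z | E t < transcriptDensity q t (x, z)},
      transcriptDensity q t (x, z) ∂(oracleComposition V t) ≤ τ t) :
    1 ≤ ∫⁻ x, ∫⁻ z, transcriptDensity q k (x, z) ∂(oracleComposition V k) ∂P +
      ∑ t ∈ Finset.range k, (E t * ENNReal.ofReal ν + τ t) := by
  induction k with
  | zero => simp [transcriptDensity]
  | succ k ih =>
    have hk := h k k.lt_succ_self
    have h' : ∀ i < k, IsTruncatedDensity P (𝒜 i) (V i) (q i) η δ ν := fun i hi =>
      h i (hi.trans k.lt_succ_self)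
    have hρ : Measurable (transcriptDensity q (k + 1)) :=
      measurable_transcriptDensity fun i hi => (h i hi).measurable
    have hρ' : Measurable (transcriptDensity q k) :=
      measurable_transcriptDensity fun i hi => (h' i hi).measurable
    have hqi : Measurable fun p : D × (∀ i : Fin k, Z i) => ∫⁻ y, q k (p, y) ∂(V k p.2) :=
      Measurable.lintegral_kernel_prod_right' (κ := (V k).comap Prod.snd measurable_snd)
        hk.measurable
    have hq1 : ∀ x z, ∫⁻ y, q k ((x, z), y) ∂(V k z) ≤ 1 := by
      intro x z
      have := hk.le x z Set.univ MeasurableSet.univ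
      rw [Measure.restrict_univ, measure_univ] at this
      exact this
    set e : D × (∀ i : Fin k, Z i) → ℝ≥0∞ := fun p => 1 - ∫⁻ y, q k (p, y) ∂(V k p.2) with he
    have hem : Measurable e := measurable_const.sub hqi
    have hez : ∀ z, ∫⁻ x, e (x, z) ∂P ≤ ENNReal.ofReal ν := by
      intro z
      have hadd : ∫⁻ x, e (x, z) ∂P + ∫⁻ x, ∫⁻ y, q k ((x, z), y) ∂(V k z) ∂P = 1 := by
        rw [← lintegral_add_left (show Measurable fun x => e (x, z) from
          hem.comp measurable_prodMk_right)]
        simp_rw [he, tsub_add_cancel_of_le (hq1 _ _)]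
        simp
      have hfin : ∫⁻ x, ∫⁻ y, q k ((x, z), y) ∂(V k z) ∂P ≠ ∞ :=
        ne_top_of_le_ne_top ENNReal.one_ne_top (hadd ▸ le_add_self)
      have hm := hk.mass z
      rw [← hadd, add_comm (∫⁻ x, e (x, z) ∂P)] at hm
      exact (ENNReal.add_le_add_iff_left hfin).1 hm
    -- Split `ρ = ρ ∫ q + ρ e`, then bound `ρ e` by `E e` or by `ρ` according to the size of `ρ`.
    have hpt : ∀ x z, transcriptDensity q k (x, z) ≤
        ∫⁻ y, transcriptDensity q k (x, z) * q k ((x, z), y) ∂(V k z) + (E k * e (x, z) +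
          {z | E k < transcriptDensity q k (x, z)}.indicator
            (fun z => transcriptDensity q k (x, z)) z) := by
      intro x z
      rw [lintegral_const_mul _ (show Measurable fun y => q k ((x, z), y) from
        hk.measurable.comp measurable_prodMk_left)]
      calc transcriptDensity q k (x, z) = transcriptDensity q k (x, z) *
            (∫⁻ y, q k ((x, z), y) ∂(V k z) + e (x, z)) := by
            rw [add_tsub_cancel_of_le (hq1 x z), mul_one]
        _ = transcriptDensity q k (x, z) * ∫⁻ y, q k ((x, z), y) ∂(V k z) +
            transcriptDensity q k (x, z) * e (x, z) := mul_add _ _ _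
        _ ≤ _ := by
            gcongr
            by_cases hz : E k < transcriptDensity q k (x, z)
            · rw [Set.indicator_of_mem (show z ∈ _ from hz)]
              exact (mul_le_of_le_one_right (by simp) tsub_le_self).trans le_add_self
            · refine le_trans ?_ le_self_add
              gcongr
              exact not_lt.1 hz
    have hx : ∀ x, ∫⁻ z, transcriptDensity q k (x, z) ∂(oracleComposition V k) ≤
        ∫⁻ z, transcriptDensity q (k + 1) (x, z) ∂(oracleComposition V (k + 1)) +
          (E k * ∫⁻ z, e (x, z) ∂(oracleComposition V k) + τ k) := by
      intro x
      have hρx : Measurable fun w => transcriptDensity q (k + 1) (x, w) :=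
        hρ.comp measurable_prodMk_left
      have hex : Measurable fun z => e (x, z) := hem.comp measurable_prodMk_left
      have hS : MeasurableSet {z | E k < transcriptDensity q k (x, z)} :=
        measurableSet_lt measurable_const (hρ'.comp measurable_prodMk_left)
      refine (lintegral_mono (hpt x)).trans ?_
      have hm1 : Measurable fun z =>
          E k * e (x, z) + {z | E k < transcriptDensity q k (x, z)}.indicator
            (fun z => transcriptDensity q k (x, z)) z :=
        (hex.const_mul _).add ((hρ'.comp measurable_prodMk_left).indicator hS)
      rw [lintegral_add_right _ hm1, lintegral_add_left (hex.const_mul _),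
        lintegral_const_mul _ hex, lintegral_indicator hS, oracleComposition,
        lintegral_map_appendOutput _ _ hρx]
      simp_rw [transcriptDensity_appendOutput]
      gcongr
      exact hE k k.lt_succ_self x
    have hint : Measurable fun x =>
        ∫⁻ z, transcriptDensity q (k + 1) (x, z) ∂(oracleComposition V (k + 1)) :=
      hρ.lintegral_prod_right'
    have hint' : Measurable fun x => ∫⁻ z, e (x, z) ∂(oracleComposition V k) :=
      hem.lintegral_prod_right'
    rw [Finset.sum_range_succ]
    calc 1 ≤ _ := ih h' fun t ht => hE t (ht.trans k.lt_succ_self)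
      _ ≤ (∫⁻ x, ∫⁻ z, transcriptDensity q (k + 1) (x, z) ∂(oracleComposition V (k + 1)) ∂P +
          (E k * ENNReal.ofReal ν + τ k)) +
          ∑ t ∈ Finset.range k, (E t * ENNReal.ofReal ν + τ t) := by
          gcongr
          refine (lintegral_mono hx).trans ?_
          rw [lintegral_add_left hint, lintegral_add_right _ measurable_const,
            lintegral_const_mul _ hint', lintegral_const, measure_univ, mul_one,
            lintegral_lintegral_swap (f := fun x z => e (x, z)) hem.aemeasurable]
          gcongr
          refine (lintegral_mono hez).trans ?_
          simp
      _ = _ := by ring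

end Composition

/-! ### Tails and indistinguishability from a density -/

section Tail

variable {T : Type*} [MeasurableSpace T] {W : Measure T} {ρ : T → ℝ≥0∞}

/-- Chernoff bound under the measure `ρ W`: where `ρ > e^ε`, one has `ρ ≤ e^{-lε} ρ^{l+1}`. The
lower tail is bounded in the same way under `W`, by means of negative powers. -/
theorem setLIntegral_lt_le_of_moment (hρ : Measurable ρ) {l ε : ℝ} (hl : 0 ≤ l) {c : ℝ≥0∞}
    (h : ∫⁻ z, ρ z ^ (l + 1) ∂W ≤ c) :
    ∫⁻ z in {z | ENNReal.ofReal (Real.exp ε) < ρ z}, ρ z ∂W ≤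
      ENNReal.ofReal (Real.exp (-(l * ε))) * c := by
  have hS : MeasurableSet {z | ENNReal.ofReal (Real.exp ε) < ρ z} :=
    measurableSet_lt measurable_const hρ
  calc ∫⁻ z in {z | ENNReal.ofReal (Real.exp ε) < ρ z}, ρ z ∂W
      ≤ ∫⁻ z in {z | ENNReal.ofReal (Real.exp ε) < ρ z},
          ENNReal.ofReal (Real.exp (-(l * ε))) * ρ z ^ (l + 1) ∂W := by
        refine setLIntegral_mono' hS fun z hz => ?_
        have hz' : ENNReal.ofReal (Real.exp ε) < ρ z := hz
        have h0 : ρ z ≠ 0 := (lt_of_le_of_lt zero_le hz').ne'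
        have h1 : ENNReal.ofReal (Real.exp (-(l * ε))) * ENNReal.ofReal (Real.exp ε) ^ l = 1 := by
          rw [ENNReal.ofReal_rpow_of_pos (Real.exp_pos _), ← Real.exp_mul,
            ← ENNReal.ofReal_mul (Real.exp_pos _).le, ← Real.exp_add]
          ring_nf
          simp
        calc ρ z = ENNReal.ofReal (Real.exp (-(l * ε))) *
              ENNReal.ofReal (Real.exp ε) ^ l * ρ z := by rw [h1, one_mul]
          _ ≤ ENNReal.ofReal (Real.exp (-(l * ε))) * ρ z ^ l * ρ z := by
              gcongr
          _ = _ := by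
              rw [mul_assoc, ENNReal.rpow_add_of_nonneg _ _ hl zero_le_one, ENNReal.rpow_one]
    _ ≤ ∫⁻ z, ENNReal.ofReal (Real.exp (-(l * ε))) * ρ z ^ (l + 1) ∂W :=
        setLIntegral_le_lintegral _ _
    _ ≤ _ := by
        rw [lintegral_const_mul _ (hρ.pow_const _)]
        gcongr

theorem measure_lt_le_of_negPow (hρ : Measurable ρ) {l ε : ℝ} (hl : 0 ≤ l) {c : ℝ≥0∞}
    (h : ∫⁻ z, negPow l (ρ z) ∂W ≤ c) :
    W {z | ρ z ≠ 0 ∧ ρ z < ENNReal.ofReal (Real.exp (-ε))} ≤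
      ENNReal.ofReal (Real.exp (-(l * ε))) * c := by
  have hS : MeasurableSet {z | ρ z ≠ 0 ∧ ρ z < ENNReal.ofReal (Real.exp (-ε))} :=
    (hρ (measurableSet_singleton 0)).compl.inter (measurableSet_lt hρ measurable_const)
  rw [← lintegral_indicator_one hS]
  calc _ ≤ ∫⁻ z, ENNReal.ofReal (Real.exp (-(l * ε))) * negPow l (ρ z) ∂W := by
        refine lintegral_mono fun z => ?_
        by_cases hz : z ∈ {z | ρ z ≠ 0 ∧ ρ z < ENNReal.ofReal (Real.exp (-ε))}
        · rw [Set.indicator_of_mem hz, Pi.one_apply, negPow_of_ne_zero l hz.1]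
          have h1 : ENNReal.ofReal (Real.exp (-(l * ε))) *
              ENNReal.ofReal (Real.exp (-ε)) ^ (-l) = 1 := by
            rw [ENNReal.ofReal_rpow_of_pos (Real.exp_pos _), ← Real.exp_mul,
              ← ENNReal.ofReal_mul (Real.exp_pos _).le, ← Real.exp_add]
            ring_nf
            simp
          rw [← h1]
          refine mul_le_mul_right ?_ _
          rw [ENNReal.rpow_neg, ENNReal.rpow_neg]
          exact ENNReal.inv_le_inv.2 (ENNReal.rpow_le_rpow hz.2.le hl)
        · rw [Set.indicator_of_notMem hz]
          exact zero_le
    _ ≤ _ := by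
        rw [lintegral_const_mul _ (show Measurable fun z => negPow l (ρ z) from
          (measurable_negPow l).comp hρ)]
        gcongr

/-- A measure `M` that dominates `ρ W` is indistinguishable from `W`, up to the mass that `ρ W`
misses and up to the tails of `ρ`. -/
theorem indistinguishable_of_density {M : Measure T} [IsProbabilityMeasure W]
    [IsProbabilityMeasure M] (hρ : Measurable ρ)
    (hle : ∀ O, MeasurableSet O → ∫⁻ z in O, ρ z ∂W ≤ M O) {ε τ s : ℝ} (hτ : 0 ≤ τ) (hs : 0 ≤ s)
    (hpos : ∫⁻ z in {z | ENNReal.ofReal (Real.exp ε) < ρ z}, ρ z ∂W ≤ ENNReal.ofReal τ)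
    (hneg : W {z | ρ z ≠ 0 ∧ ρ z < ENNReal.ofReal (Real.exp (-ε))} ≤ ENNReal.ofReal τ)
    (hmass : 1 - ∫⁻ z, ρ z ∂W ≤ ENNReal.ofReal s) (hnull : W {z | ρ z = 0} ≤ ENNReal.ofReal s) :
    Indistinguishable ε (τ + s) M W := by
  intro O hO
  have toReal : ∀ (μ μ' : Measure T) [IsProbabilityMeasure μ] [IsProbabilityMeasure μ'],
      μ O ≤ ENNReal.ofReal (Real.exp ε) * μ' O + ENNReal.ofReal τ + ENNReal.ofReal s →
      μ.real O ≤ Real.exp ε * μ'.real O + (τ + s) := by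
    intro μ μ' _ _ h
    rw [← add_assoc]
    have := ENNReal.toReal_mono (by finiteness) h
    rwa [ENNReal.toReal_add (by finiteness) (by finiteness),
      ENNReal.toReal_add (by finiteness) (by finiteness), ENNReal.toReal_mul,
      ENNReal.toReal_ofReal hτ, ENNReal.toReal_ofReal hs,
      ENNReal.toReal_ofReal (Real.exp_pos ε).le] at this
  have hsplit : ∫⁻ z, ρ z ∂W = ∫⁻ z in O, ρ z ∂W + ∫⁻ z in Oᶜ, ρ z ∂W :=
    (lintegral_add_compl _ hO).symm
  have hSm : MeasurableSet {z | ENNReal.ofReal (Real.exp ε) < ρ z} :=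
    measurableSet_lt measurable_const hρ
  constructor
  · refine toReal M W ?_
    -- `M` may have mass outside `ρ W`, but at most `s` in total: bounding `M Oᶜ` below by `ρ W`
    -- leaves `M O ≤ ∫_O ρ + s`.
    have h1 : M O + M Oᶜ ≤ ∫⁻ z, ρ z ∂W + ENNReal.ofReal s := by
      rw [measure_add_measure_compl hO, measure_univ]
      exact tsub_le_iff_left.1 hmass
    have h2 : M O + ∫⁻ z in Oᶜ, ρ z ∂W ≤
        (∫⁻ z in O, ρ z ∂W + ENNReal.ofReal s) + ∫⁻ z in Oᶜ, ρ z ∂W := by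
      calc _ ≤ M O + M Oᶜ := by gcongr; exact hle _ hO.compl
        _ ≤ _ := h1
        _ = _ := by rw [hsplit]; ring
    have hfin : ∫⁻ z in Oᶜ, ρ z ∂W ≠ ∞ :=
      ne_top_of_le_ne_top (measure_ne_top M Oᶜ) (hle _ hO.compl)
    refine ((ENNReal.add_le_add_iff_right hfin).1 h2).trans ?_
    gcongr
    calc ∫⁻ z in O, ρ z ∂W
        ≤ ∫⁻ z in O, (ENNReal.ofReal (Real.exp ε) +
            {z | ENNReal.ofReal (Real.exp ε) < ρ z}.indicator ρ z) ∂W := by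
          refine lintegral_mono fun z => ?_
          by_cases hz : ENNReal.ofReal (Real.exp ε) < ρ z
          · rw [Set.indicator_of_mem (show z ∈ _ from hz)]
            exact le_add_self
          · exact (not_lt.1 hz).trans le_self_add
      _ = ENNReal.ofReal (Real.exp ε) * W O +
          ∫⁻ z in O, {z | ENNReal.ofReal (Real.exp ε) < ρ z}.indicator ρ z ∂W := by
          rw [lintegral_add_left measurable_const, setLIntegral_const]
      _ ≤ _ := by
          gcongr
          refine (setLIntegral_le_lintegral _ _).trans ?_
          rw [lintegral_indicator hSm]
          exact hpos
  · refine toReal W M ?_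
    have hcover : O ⊆ ({z | ENNReal.ofReal (Real.exp (-ε)) ≤ ρ z} ∩ O) ∪
        ({z | ρ z ≠ 0 ∧ ρ z < ENNReal.ofReal (Real.exp (-ε))} ∪ {z | ρ z = 0}) := by
      intro z hz
      by_cases h0 : ρ z = 0
      · exact Or.inr (Or.inr h0)
      · by_cases h1 : ρ z < ENNReal.ofReal (Real.exp (-ε))
        · exact Or.inr (Or.inl ⟨h0, h1⟩)
        · exact Or.inl ⟨not_lt.1 h1, hz⟩
    have hbig : W ({z | ENNReal.ofReal (Real.exp (-ε)) ≤ ρ z} ∩ O) ≤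
        ENNReal.ofReal (Real.exp ε) * M O := by
      have hm : MeasurableSet ({z | ENNReal.ofReal (Real.exp (-ε)) ≤ ρ z} ∩ O) :=
        (measurableSet_le measurable_const hρ).inter hO
      have h1 : ENNReal.ofReal (Real.exp ε) * ENNReal.ofReal (Real.exp (-ε)) = 1 := by
        rw [← ENNReal.ofReal_mul (Real.exp_pos _).le, ← Real.exp_add]; simp
      calc _ = ENNReal.ofReal (Real.exp ε) * (ENNReal.ofReal (Real.exp (-ε)) *
            W ({z | ENNReal.ofReal (Real.exp (-ε)) ≤ ρ z} ∩ O)) := by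
            rw [← mul_assoc, h1, one_mul]
        _ ≤ ENNReal.ofReal (Real.exp ε) *
            ∫⁻ z in ({z | ENNReal.ofReal (Real.exp (-ε)) ≤ ρ z} ∩ O), ρ z ∂W := by
            refine mul_le_mul_right ?_ _
            rw [← setLIntegral_const]
            exact setLIntegral_mono' hm fun z hz => hz.1
        _ ≤ _ := by
            refine mul_le_mul_right ?_ _
            exact (hle _ hm).trans (measure_mono Set.inter_subset_right)
    calc W O ≤ _ := measure_mono hcover
      _ ≤ _ := measure_union_le _ _
      _ ≤ ENNReal.ofReal (Real.exp ε) * M O + (ENNReal.ofReal τ + ENNReal.ofReal s) :=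
          add_le_add hbig ((measure_union_le _ _).trans (add_le_add hneg hnull))
      _ = _ := (add_assoc _ _ _).symm

end Tail

/-! ### Markov's inequality over the data, and the two composition bounds -/

section Composition

variable {D : Type*} [MeasurableSpace D] {Z : ℕ → Type*} [∀ i, MeasurableSpace (Z i)]
  {q : ∀ i : ℕ, (D × (∀ j : Fin i, Z j)) × Z i → ℝ≥0∞}
  {P : Measure D} [IsProbabilityMeasure P]
  {𝒜 : ∀ i : ℕ, Kernel (D × (∀ j : Fin i, Z j)) (Z i)} [∀ i, IsMarkovKernel (𝒜 i)]
  {V : ∀ i : ℕ, Kernel (∀ j : Fin i, Z j) (Z i)} [∀ i, IsMarkovKernel (V i)] {η δ ν : ℝ}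

/-- The missed mass and the null mass have a total average over the data of at most `ν' s`. By
Markov's inequality their sum reaches `s` with probability at most `ν'`, and for all other data
`indistinguishable_of_density` applies. -/
theorem one_sub_le_measureReal_indistinguishable {k : ℕ}
    (h : ∀ i < k, IsTruncatedDensity P (𝒜 i) (V i) (q i) η δ ν) (hν : 0 ≤ ν) {ε τ : ℕ → ℝ}
    (hτ : ∀ t, 0 ≤ τ t)
    (hpos : ∀ t ≤ k, ∀ x, ∫⁻ z in {z | ENNReal.ofReal (Real.exp (ε t)) <
      transcriptDensity q t (x, z)}, transcriptDensity q t (x, z) ∂(oracleComposition V t) ≤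
        ENNReal.ofReal (τ t))
    (hneg : ∀ x, oracleComposition V k {z | transcriptDensity q k (x, z) ≠ 0 ∧
      transcriptDensity q k (x, z) < ENNReal.ofReal (Real.exp (-ε k))} ≤ ENNReal.ofReal (τ k))
    {s ν' : ℝ} (hs : 0 < s)
    (hβ : ∑ t ∈ Finset.range k, (Real.exp (ε t) * ν + τ t) + k * ν ≤ ν' * s) :
    1 - ν' ≤ P.real {x | Indistinguishable (ε k) (τ k + s) (adaptiveComposition 𝒜 k x)
      (oracleComposition V k)} := by
  have hρ : Measurable (transcriptDensity q k) :=
    measurable_transcriptDensity fun i hi => (h i hi).measurable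
  have hρx : ∀ x, Measurable fun z => transcriptDensity q k (x, z) := fun x =>
    hρ.comp measurable_prodMk_left
  have hle : ∀ x O, MeasurableSet O →
      ∫⁻ z in O, transcriptDensity q k (x, z) ∂(oracleComposition V k) ≤
        adaptiveComposition 𝒜 k x O := by
    intro x O hO
    have h1 := lintegral_mul_transcriptDensity_le h x
      (f := O.indicator 1) (measurable_one.indicator hO)
    rw [lintegral_indicator_one hO] at h1
    refine le_trans ?_ h1
    rw [← lintegral_indicator hO]
    refine lintegral_mono fun z => ?_
    by_cases hz : z ∈ O
    · simp [hz]
    · simp [hz]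
  set I : D → ℝ≥0∞ := fun x => ∫⁻ z, transcriptDensity q k (x, z) ∂(oracleComposition V k)
    with hI
  set N : D → ℝ≥0∞ := fun x => oracleComposition V k {z | transcriptDensity q k (x, z) = 0}
    with hN
  have hIm : Measurable I := hρ.lintegral_prod_right'
  have hNm : Measurable N := measurable_measure_prodMk_left (hρ (measurableSet_singleton 0))
  have hI1 : ∀ x, I x ≤ 1 := by
    intro x
    have := hle x Set.univ MeasurableSet.univ
    rwa [Measure.restrict_univ, measure_univ] at this
  set β : ℝ := ∑ t ∈ Finset.range k, (Real.exp (ε t) * ν + τ t) with hβd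
  have hβ0 : 0 ≤ β := Finset.sum_nonneg fun t _ => by
    have := Real.exp_pos (ε t); have := hτ t; positivity
  have hmass : ∫⁻ x, (1 - I x) ∂P ≤ ENNReal.ofReal β := by
    have h1 := one_le_lintegral_transcriptDensity_add h
      (E := fun t => ENNReal.ofReal (Real.exp (ε t))) (τ := fun t => ENNReal.ofReal (τ t))
      fun t ht => hpos t ht.le
    have h2 : ∑ t ∈ Finset.range k, (ENNReal.ofReal (Real.exp (ε t)) * ENNReal.ofReal ν +
        ENNReal.ofReal (τ t)) = ENNReal.ofReal β := by
      rw [hβd, ENNReal.ofReal_sum_of_nonneg fun t _ => by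
        have := Real.exp_pos (ε t); have := hτ t; positivity]
      refine Finset.sum_congr rfl fun t _ => ?_
      rw [ENNReal.ofReal_add (by have := Real.exp_pos (ε t); positivity) (hτ t),
        ENNReal.ofReal_mul (Real.exp_pos _).le]
    rw [h2] at h1
    have hadd : ∫⁻ x, (1 - I x) ∂P + ∫⁻ x, I x ∂P = 1 := by
      rw [← lintegral_add_right _ hIm]
      simp_rw [tsub_add_cancel_of_le (hI1 _)]
      simp
    have hfin : ∫⁻ x, I x ∂P ≠ ∞ := ne_top_of_le_ne_top ENNReal.one_ne_top (hadd ▸ le_add_self)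
    rw [← hadd, add_comm] at h1
    exact (ENNReal.add_le_add_iff_left hfin).1 h1
  have hnull : ∫⁻ x, N x ∂P ≤ ENNReal.ofReal (k * ν) := by
    have := lintegral_transcriptDensity_eq_zero_le h
    rwa [ENNReal.ofReal_mul (by positivity), ENNReal.ofReal_natCast]
  have hFm : Measurable fun x => (1 - I x) + N x := (measurable_const.sub hIm).add hNm
  have hF : ∫⁻ x, ((1 - I x) + N x) ∂P ≤ ENNReal.ofReal (ν' * s) := by
    rw [lintegral_add_right _ hNm]
    refine (add_le_add hmass hnull).trans ?_
    rw [← ENNReal.ofReal_add hβ0 (by positivity)]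
    exact ENNReal.ofReal_le_ofReal hβ
  have hν' : 0 ≤ ν' := by
    have h1 : 0 ≤ ν' * s := le_trans (by positivity) hβ
    exact nonneg_of_mul_nonneg_left h1 hs
  have hmarkov := mul_meas_ge_le_lintegral (μ := P) hFm (ENNReal.ofReal s)
  have hbad : P.real {x | ENNReal.ofReal s ≤ (1 - I x) + N x} ≤ ν' := by
    have h1 := ENNReal.toReal_mono ENNReal.ofReal_ne_top (hmarkov.trans hF)
    rw [ENNReal.toReal_mul, ENNReal.toReal_ofReal hs.le,
      ENNReal.toReal_ofReal (by positivity), mul_comm] at h1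
    exact le_of_mul_le_mul_right h1 hs
  have hbadm : MeasurableSet {x | ENNReal.ofReal s ≤ (1 - I x) + N x} :=
    measurableSet_le measurable_const hFm
  have hgood : 1 - ν' ≤ P.real {x | ENNReal.ofReal s ≤ (1 - I x) + N x}ᶜ := by
    rw [probReal_compl_eq_one_sub hbadm]
    linarith
  refine hgood.trans (measureReal_mono (fun x hx => ?_) (measure_ne_top _ _))
  have hx' : (1 - I x) + N x ≤ ENNReal.ofReal s := by
    by_contra hc
    exact hx (not_le.1 hc).le
  exact indistinguishable_of_density (hρx x) (hle x) (hτ k) hs.le (hpos k le_rfl x) (hneg x)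
    (le_self_add.trans hx') (le_add_self.trans hx')

end Composition

theorem Indistinguishable.mono {Z : Type*} [MeasurableSpace Z] {η η' τ τ' : ℝ}
    {μ μ' : Measure Z} (h : Indistinguishable η τ μ μ') (hη : η ≤ η') (hτ : τ ≤ τ') :
    Indistinguishable η' τ' μ μ' := by
  intro O hO
  have he := Real.exp_le_exp.2 hη
  have h1 := mul_le_mul_of_nonneg_right he (measureReal_nonneg (μ := μ) (s := O))
  have h2 := mul_le_mul_of_nonneg_right he (measureReal_nonneg (μ := μ') (s := O))
  obtain ⟨h3, h4⟩ := h O hO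
  constructor <;> linarith

theorem TypicallyStable.mono {D Z : Type*} [MeasurableSpace D] [MeasurableSpace Z]
    {𝓟 : Set (ProbabilityMeasure D)} {𝒜 : Kernel D Z} {η τ ν η' τ' ν' : ℝ}
    (h : TypicallyStable 𝓟 𝒜 η τ ν) (hη : η ≤ η') (hτ : τ ≤ τ') (hν : ν ≤ ν') :
    TypicallyStable 𝓟 𝒜 η' τ' ν' := by
  intro P hP
  obtain ⟨W, hW⟩ := h P hP
  refine ⟨W, le_trans (by linarith) (hW.trans ?_)⟩
  exact measureReal_mono (fun x hx => Indistinguishable.mono hx hη hτ) (measure_ne_top _ _)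

/-- Stability is vacuous for `ν ≥ 1`, which allows the restriction to `ν* < 1` later on. -/
theorem typicallyStable_of_one_le {D Z : Type*} [MeasurableSpace D] [MeasurableSpace Z]
    {𝓟 : Set (ProbabilityMeasure D)} {𝒜 : Kernel D Z} [IsMarkovKernel 𝒜] {η τ ν : ℝ}
    (hν : 1 ≤ ν) : TypicallyStable 𝓟 𝒜 η τ ν := by
  intro P _
  obtain ⟨x⟩ := (P : Measure D).nonempty_of_neZero
  exact ⟨⟨𝒜 x, inferInstance⟩, le_trans (by linarith) measureReal_nonneg⟩

section Composition

variable {D : Type*} [MeasurableSpace D] {Z : ℕ → Type*} [∀ i, MeasurableSpace (Z i)]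
  {q : ∀ i : ℕ, (D × (∀ j : Fin i, Z j)) × Z i → ℝ≥0∞}
  {P : Measure D} {𝒜 : ∀ i : ℕ, Kernel (D × (∀ j : Fin i, Z j)) (Z i)}
  {V : ∀ i : ℕ, Kernel (∀ j : Fin i, Z j) (Z i)} {η δ ν : ℝ}

theorem exists_truncatedDensity_sequence [∀ i, MeasurableSpace.CountablyGenerated (Z i)]
    [∀ i, IsMarkovKernel (𝒜 i)] {𝓟 : Set (ProbabilityMeasure D)} {k : ℕ} {η' : ℝ}
    (h : ∀ i < k, ∀ z : ∀ j : Fin i, Z j, TypicallyStable 𝓟 ((𝒜 i).sectL z) η 0 ν)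
    (hη : 0 < η) (hη' : η < η') (hν : 0 ≤ ν) (hν1 : ν < 1) (hδ : 0 < δ)
    {P : ProbabilityMeasure D} (hP : P ∈ 𝓟) :
    ∃ (V : ∀ i : ℕ, Kernel (∀ j : Fin i, Z j) (Z i))
      (q : ∀ i : ℕ, (D × (∀ j : Fin i, Z j)) × Z i → ℝ≥0∞), (∀ i, IsMarkovKernel (V i)) ∧
      ∀ i < k, IsTruncatedDensity (P : Measure D) (𝒜 i) (V i) (q i) η' δ (ν + δ) := by
  have hex : ∀ i, ∃ (V : Kernel (∀ j : Fin i, Z j) (Z i))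
      (q : (D × (∀ j : Fin i, Z j)) × Z i → ℝ≥0∞), IsMarkovKernel V ∧
      (i < k → IsTruncatedDensity (P : Measure D) (𝒜 i) V q η' δ (ν + δ)) := by
    intro i
    by_cases hi : i < k
    · obtain ⟨V, hV, hVn⟩ := exists_measurable_oracle (P : Measure D) (𝒜 i) hη.le hη' hν1 hδ
        fun z => h i hi z P hP
      obtain ⟨q, hq⟩ := exists_isTruncatedDensity (P : Measure D) (𝒜 i) V (hη.trans hη') hν hδ.le
        hVn
      exact ⟨V, q, hV, fun _ => hq⟩
    -- Steps numbered `k` or more only need some Markov kernel: the algorithm at an arbitrary data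
    -- point.
    · obtain ⟨x⟩ := (P : Measure D).nonempty_of_neZero
      exact ⟨(𝒜 i).sectR x, fun _ => 0, inferInstance, fun h => absurd h hi⟩
  choose V q hV hq using hex
  exact ⟨V, q, hV, hq⟩

theorem ratioRange_mul {η η' : ℝ} {r r' : ℝ≥0∞} (hr : r ∈ ratioRange η)
    (hr' : r' ∈ ratioRange η') : r * r' ∈ ratioRange (η + η') := by
  constructor
  · rw [neg_add, Real.exp_add, ENNReal.ofReal_mul (Real.exp_pos _).le]
    exact mul_le_mul' hr.1 hr'.1
  · rw [Real.exp_add, ENNReal.ofReal_mul (Real.exp_pos _).le]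
    exact mul_le_mul' hr.2 hr'.2

theorem transcriptDensity_eq_zero_or_mem {k : ℕ}
    (h : ∀ i < k, IsTruncatedDensity P (𝒜 i) (V i) (q i) η δ ν) (p : D × (∀ i : Fin k, Z i)) :
    transcriptDensity q k p = 0 ∨ transcriptDensity q k p ∈ ratioRange (k * η) := by
  induction k with
  | zero => right; simp [transcriptDensity, ratioRange]
  | succ k ih =>
    rcases ih (fun i hi => h i (hi.trans k.lt_succ_self))
      (p.1, Fin.init (α := fun i : Fin (k + 1) => Z i) p.2) with h1 | h1
    · exact Or.inl (mul_eq_zero_of_left h1 _)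
    · rcases (h k k.lt_succ_self).range
        ((p.1, Fin.init (α := fun i : Fin (k + 1) => Z i) p.2), p.2 (Fin.last k)) with h2 | h2
      · exact Or.inl (mul_eq_zero_of_right _ h2)
      · have h3 := ratioRange_mul h1 h2
        rw [← add_one_mul, ← Nat.cast_succ] at h3
        exact Or.inr h3

/-- Composition with the losses of the steps added up. -/
theorem typicallyStable_adaptiveComposition_of_sum
    [∀ i, MeasurableSpace.CountablyGenerated (Z i)] [∀ i, IsMarkovKernel (𝒜 i)]
    {𝓟 : Set (ProbabilityMeasure D)} {k : ℕ} {η' s : ℝ}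
    (h : ∀ i < k, ∀ z : ∀ j : Fin i, Z j, TypicallyStable 𝓟 ((𝒜 i).sectL z) η 0 ν)
    (hη : 0 < η) (hη' : η < η') (hν : 0 ≤ ν) (hν1 : ν < 1) (hδ : 0 < δ) (hs : 0 < s) {ν' : ℝ}
    (hβ : ∑ t ∈ Finset.range k, Real.exp (t * η') * (ν + δ) + k * (ν + δ) ≤ ν' * s) :
    TypicallyStable 𝓟 (adaptiveComposition 𝒜 k) (k * η') s ν' := by
  intro P hP
  obtain ⟨V, q, hV, hq⟩ := exists_truncatedDensity_sequence h hη hη' hν hν1 hδ hP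
  refine ⟨⟨oracleComposition V k, inferInstance⟩, ?_⟩
  -- The nonzero values of `ρ_t` always lie in `[e^{-tη'}, e^{tη'}]`, so both tails are empty and `τ
  -- = 0`.
  have := one_sub_le_measureReal_indistinguishable hq (by positivity) (ε := fun t => t * η')
    (τ := fun _ => 0) (fun _ => le_rfl) (fun t ht x => ?_) (fun x => ?_) hs (by simpa using hβ)
  · simpa using this
  · have hemp : {z | ENNReal.ofReal (Real.exp (t * η')) < transcriptDensity q t (x, z)} = ∅ := by
      refine Set.eq_empty_iff_forall_notMem.2 fun z hz => ?_
      have hz' : ENNReal.ofReal (Real.exp (t * η')) < transcriptDensity q t (x, z) := hz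
      rcases transcriptDensity_eq_zero_or_mem (fun i hi => hq i (hi.trans_le ht)) (x, z)
        with h1 | h1
      · rw [h1] at hz'; exact not_lt_zero hz'
      · exact not_lt.2 h1.2 hz'
    rw [hemp]; simp
  · have hemp : {z | transcriptDensity q k (x, z) ≠ 0 ∧
        transcriptDensity q k (x, z) < ENNReal.ofReal (Real.exp (-(k * η')))} = ∅ := by
      refine Set.eq_empty_iff_forall_notMem.2 fun z hz => ?_
      rcases transcriptDensity_eq_zero_or_mem hq (x, z) with h1 | h1
      · exact hz.1 h1
      · exact not_lt.2 h1.1 hz.2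
    rw [hemp]; simp

/-- The loss of `t` steps, off an event of probability of order `e^{-L}`. -/
noncomputable def concentratedLoss (η L : ℝ) (t : ℕ) : ℝ :=
  Real.sqrt (2 * t * L) * η + t * η ^ 2 / 2

/-- The order of the moment that controls the loss of `t` steps. -/
noncomputable def momentOrder (η L : ℝ) (t : ℕ) : ℝ := Real.sqrt (2 * L / t) / η

/-- The terms `t l η² / 2` cancel, leaving the exponent `-l η √(2tL) + t (l η)² / 2`. Its minimum
`-L` is attained at `l η = √(2L / t)`, which is the choice of `momentOrder`. The `δ`-correction
costs a factor `e^{1/(2k)}` per step, at most `e^{1/2} ≤ 2` in all. -/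
theorem exp_mul_momentBound_pow_le {η L δ : ℝ} {t k : ℕ} (hη : 0 < η) (hL : 0 ≤ L) (ht : 1 ≤ t)
    (htk : t ≤ k) (hδ0 : 0 ≤ δ)
    (hδ : Real.sinh (momentOrder η L t * η) / Real.sinh η * δ ≤ 1 / (2 * k)) :
    Real.exp (-(momentOrder η L t * concentratedLoss η L t)) *
      momentBound η (momentOrder η L t) δ ^ t ≤ 2 * Real.exp (-L) := by
  set l := momentOrder η L t with hl
  have hl0 : 0 ≤ l := by rw [hl, momentOrder]; positivity
  have ht0 : (0 : ℝ) < t := by exact_mod_cast ht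
  have hk0 : (0 : ℝ) < k := ht0.trans_le (by exact_mod_cast htk)
  have hsinh : 0 ≤ Real.sinh (l * η) / Real.sinh η := div_nonneg
    (Real.sinh_nonneg_iff.2 (by positivity)) (Real.sinh_nonneg_iff.2 hη.le)
  have hlη : l * η = Real.sqrt (2 * L / t) := by
    rw [hl, momentOrder]; field_simp
  have hsq : (l * η) ^ 2 = 2 * L / t := by rw [hlη, Real.sq_sqrt (by positivity)]
  have hcross : l * η * Real.sqrt (2 * t * L) = 2 * L := by
    rw [hlη, ← Real.sqrt_mul (by positivity)]
    have : 2 * L / t * (2 * t * L) = (2 * L) ^ 2 := by field_simp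
    rw [this, Real.sqrt_sq (by positivity)]
  have hb : momentBound η l δ ≤ Real.exp (l * (l + 1) * η ^ 2 / 2) * Real.exp (1 / (2 * k)) := by
    have h1 : 1 ≤ Real.exp (l * (l + 1) * η ^ 2 / 2) := Real.one_le_exp (by positivity)
    have h2 : 1 / (2 * (k : ℝ)) + 1 ≤ Real.exp (1 / (2 * k)) := Real.add_one_le_exp _
    have h3 : 0 ≤ 1 / (2 * (k : ℝ)) := by positivity
    rw [momentBound]
    calc _ ≤ Real.exp (l * (l + 1) * η ^ 2 / 2) + 1 / (2 * k) := by linarith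
      _ ≤ Real.exp (l * (l + 1) * η ^ 2 / 2) * (1 / (2 * (k : ℝ)) + 1) := by nlinarith
      _ ≤ _ := by gcongr
  have hb0 : 0 ≤ momentBound η l δ := by unfold momentBound; positivity
  calc _ ≤ Real.exp (-(l * concentratedLoss η L t)) *
        (Real.exp (l * (l + 1) * η ^ 2 / 2) * Real.exp (1 / (2 * k))) ^ t := by gcongr
    _ = Real.exp (-L) * Real.exp (t * (1 / (2 * k))) := by
        rw [← Real.exp_add, ← Real.exp_nat_mul, ← Real.exp_add, ← Real.exp_add]
        congr 1
        rw [concentratedLoss]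
        have h4 : (t : ℝ) * (l * η) ^ 2 = 2 * L := by rw [hsq]; field_simp
        linear_combination -hcross + h4 / 2
    _ ≤ Real.exp (-L) * Real.exp (1 / 2) := by
        gcongr
        have : (t : ℝ) ≤ k := by exact_mod_cast htk
        rw [mul_one_div, div_le_div_iff₀ (by positivity) (by norm_num)]
        linarith
    _ ≤ _ := by
        rw [mul_comm]
        gcongr
        have h5 : Real.exp (1 / 2) ^ 2 = Real.exp 1 := by rw [← Real.exp_nat_mul]; norm_num
        have h6 := Real.exp_one_lt_d9
        nlinarith [Real.exp_pos (1 / 2)]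

/-- Composition with the losses of the steps concentrated around their mean. -/
theorem typicallyStable_adaptiveComposition_of_concentration
    [∀ i, MeasurableSpace.CountablyGenerated (Z i)] [∀ i, IsMarkovKernel (𝒜 i)]
    {𝓟 : Set (ProbabilityMeasure D)} {k : ℕ} {η' L s : ℝ}
    (h : ∀ i < k, ∀ z : ∀ j : Fin i, Z j, TypicallyStable 𝓟 ((𝒜 i).sectL z) η 0 ν)
    (hη : 0 < η) (hη' : η < η') (hν : 0 ≤ ν) (hν1 : ν < 1) (hL : 0 ≤ L) (hδ : 0 < δ) (hs : 0 < s)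
    (hδk : ∀ t : ℕ, 1 ≤ t → t ≤ k →
      Real.sinh (momentOrder η' L t * η') / Real.sinh η' * δ ≤ 1 / (2 * k)) {ν' : ℝ}
    (hβ : ∑ t ∈ Finset.range k, (Real.exp (concentratedLoss η' L t) * (ν + δ) +
      2 * Real.exp (-L)) + k * (ν + δ) ≤ ν' * s) :
    TypicallyStable 𝓟 (adaptiveComposition 𝒜 k) (concentratedLoss η' L k)
      (2 * Real.exp (-L) + s) ν' := by
  intro P hP
  have hη0 : 0 < η' := hη.trans hη'
  obtain ⟨V, q, hV, hq⟩ := exists_truncatedDensity_sequence h hη hη' hν hν1 hδ hP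
  refine ⟨⟨oracleComposition V k, inferInstance⟩, ?_⟩
  have hl0 : ∀ t, 0 ≤ momentOrder η' L t := fun t => by unfold momentOrder; positivity
  have htail : ∀ t : ℕ, 1 ≤ t → t ≤ k →
      ENNReal.ofReal (Real.exp (-(momentOrder η' L t * concentratedLoss η' L t))) *
        ENNReal.ofReal (momentBound η' (momentOrder η' L t) δ) ^ t ≤
      ENNReal.ofReal (2 * Real.exp (-L)) := by
    intro t ht htk
    have hb0 : 0 ≤ momentBound η' (momentOrder η' L t) δ := by
      have : 0 ≤ Real.sinh (momentOrder η' L t * η') / Real.sinh η' := div_nonneg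
        (Real.sinh_nonneg_iff.2 (mul_nonneg (hl0 t) hη0.le)) (Real.sinh_nonneg_iff.2 hη0.le)
      unfold momentBound
      positivity
    rw [← ENNReal.ofReal_pow hb0, ← ENNReal.ofReal_mul (Real.exp_pos _).le]
    exact ENNReal.ofReal_le_ofReal
      (exp_mul_momentBound_pow_le hη0 hL ht htk hδ.le (hδk t ht htk))
  have hρ : ∀ t ≤ k, ∀ x, Measurable fun z => transcriptDensity q t (x, z) := fun t ht x =>
    (measurable_transcriptDensity fun i hi => (hq i (hi.trans_le ht)).measurable).comp
      measurable_prodMk_left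
  refine one_sub_le_measureReal_indistinguishable hq (by positivity)
    (ε := concentratedLoss η' L) (τ := fun _ => 2 * Real.exp (-L)) (fun _ => by positivity)
    (fun t ht x => ?_) (fun x => ?_) hs hβ
  -- The empty transcript has density one and loss zero, so its tail is empty; the moment bound
  -- would give nothing here.
  · rcases Nat.eq_zero_or_pos t with rfl | ht0
    · simp [concentratedLoss, transcriptDensity]
    · refine (setLIntegral_lt_le_of_moment (hρ t ht x) (hl0 t) ?_).trans (htail t ht0 ht)
      refine lintegral_multiplicative_transcriptDensity_le
        (fun i hi => (hq i (hi.trans_le ht)).measurable)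
        (φ := fun r => r ^ (momentOrder η' L t + 1)) (by fun_prop) (ENNReal.one_rpow _)
        (fun a b => ENNReal.mul_rpow_of_nonneg _ _ (by have := hl0 t; positivity)) x
        fun i hi z => (hq i (hi.trans_le ht)).moment _ (hl0 t) x z
  · rcases Nat.eq_zero_or_pos k with rfl | hk0
    · simp [concentratedLoss, transcriptDensity]
    · refine (measure_lt_le_of_negPow (hρ k le_rfl x) (hl0 k) ?_).trans (htail k hk0 le_rfl)
      exact lintegral_multiplicative_transcriptDensity_le (fun i hi => (hq i hi).measurable)
        (measurable_negPow _) (by rw [negPow_of_ne_zero _ one_ne_zero, ENNReal.one_rpow])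
        (negPow_mul _) x fun i hi z => (hq i hi).moment_neg _ (hl0 k) x z

end Composition

/-! ### Comparison with the stated parameters -/

/-- The room comes from `t η (e^η - 1) ≥ t η²`, against `t η² / 2` in the concentrated loss. One `θ`
serves all `t ≥ 1` since `√(2tL) ≤ t √(2L)`: it raises the quadratic term to at most `3/4 t η²` and
adds at most `t η² / 4` to the root term. -/
theorem exists_gt_concentratedLoss_le_etaStep {η τ' : ℝ} (hη : 0 < η) (hτ' : 0 < τ')
    (hτ'1 : τ' < 1) : ∃ η', η < η' ∧ ∀ t : ℕ, 1 ≤ t →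
      concentratedLoss η' (Real.log (1 / τ')) t ≤ etaStep η τ' t := by
  have hL : 0 < Real.log (1 / τ') := Real.log_pos ((one_lt_div hτ').2 hτ'1)
  set L := Real.log (1 / τ') with hLd
  set a := Real.sqrt (2 * L) with ha
  have ha0 : 0 ≤ a := Real.sqrt_nonneg _
  set θ := min (η / 5) (η ^ 2 / (4 * (a + 1))) with hθ
  have hθ0 : 0 < θ := lt_min (by positivity) (by positivity)
  have hθ1 : θ ≤ η / 5 := min_le_left _ _
  have hθ2 : a * θ ≤ η ^ 2 / 4 := by
    have h1 : θ ≤ η ^ 2 / (4 * (a + 1)) := min_le_right _ _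
    rw [le_div_iff₀ (by positivity)] at h1
    nlinarith
  refine ⟨η + θ, by linarith, fun t ht => ?_⟩
  have ht1 : (1 : ℝ) ≤ t := by exact_mod_cast ht
  have hroot : Real.sqrt (2 * t * L) ≤ t * a := by
    rw [ha, mul_right_comm, Real.sqrt_mul (by positivity), mul_comm]
    gcongr
    exact Real.sqrt_le_iff.2 ⟨by positivity, by nlinarith⟩
  have hexp : η ≤ Real.exp η - 1 := by linarith [Real.add_one_le_exp η]
  rw [concentratedLoss, etaStep, ← hLd]
  have h1 : Real.sqrt (2 * t * L) * θ ≤ t * (η ^ 2 / 4) := by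
    calc _ ≤ t * a * θ := by gcongr
      _ = t * (a * θ) := by ring
      _ ≤ _ := by gcongr
  have h2 : (η + θ) ^ 2 / 2 ≤ 3 / 4 * η ^ 2 := by nlinarith
  have h3 : t * (η + θ) ^ 2 / 2 ≤ t * (3 / 4 * η ^ 2) := by
    rw [mul_div_assoc]; gcongr
  have h4 : t * η * η ≤ t * η * (Real.exp η - 1) := by gcongr
  nlinarith

theorem etaStep_nonneg {η τ' : ℝ} (hη : 0 < η) (t : ℕ) : 0 ≤ etaStep η τ' t := by
  have hexp : 0 ≤ Real.exp η - 1 := by linarith [Real.add_one_le_exp η]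
  unfold etaStep
  positivity

theorem etaStep_le_etaStar {η τ' : ℝ} (hη : 0 < η) (hτ' : 0 < τ') (hτ'1 : τ' < 1) {t k : ℕ}
    (htk : t ≤ k) : etaStep η τ' t ≤ etaStar k η τ' := by
  have hL : 0 < Real.log (1 / τ') := Real.log_pos ((one_lt_div hτ').2 hτ'1)
  have hexp : 0 ≤ Real.exp η - 1 := by linarith [Real.add_one_le_exp η]
  have h : (t : ℝ) ≤ k := by exact_mod_cast htk
  have h1 : etaStep η τ' t ≤ etaStep η τ' k := by unfold etaStep; gcongr
  have h2 : etaStar k η τ' = 3 * etaStep η τ' k := by unfold etaStar etaStep; ring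
  linarith [etaStep_nonneg (τ' := τ') hη k]

theorem nuStar_eq {k : ℕ} {η ν τ' : ℝ} : nuStar k η ν τ' =
    5 * Real.sqrt ((k * τ' + ν * (1 + ∑ t ∈ Finset.Ico 1 k, Real.exp (etaStep η τ' t))) / η) := by
  rw [nuStar, ← Finset.sum_div, ← Finset.sum_mul]
  ring_nf

section Stability

variable {D : Type u} [MeasurableSpace D] {𝓟 : Set (ProbabilityMeasure D)} {k : ℕ} {η ν τ' : ℝ}

theorem satisfiesStability_of_le_two (hk : 2 ≤ k) (hη : 0 < η) (hη2 : η ≤ 2) (hν : 0 ≤ ν)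
    (hν1 : ν < 1) (hτ' : 0 < τ') (hτ'1 : τ' < 1) :
    SatisfiesStabilityUnderComposition.{u, v} 𝓟 k η 0 ν
      (etaStar k η τ') (nuStar k η ν τ') (nuStar k η ν τ') := by
  intro Z _ _ 𝒜 _ h
  by_cases hbig : 1 ≤ nuStar k η ν τ'
  · exact typicallyStable_of_one_le hbig
  rw [not_le, nuStar_eq] at hbig
  rw [nuStar_eq]
  have hL : 0 < Real.log (1 / τ') := Real.log_pos ((one_lt_div hτ').2 hτ'1)
  set L := Real.log (1 / τ') with hLd
  have hexpL : Real.exp (-L) = τ' := by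
    rw [hLd, one_div, Real.log_inv, neg_neg, Real.exp_log hτ']
  set E := 1 + ∑ t ∈ Finset.Ico 1 k, Real.exp (etaStep η τ' t) with hE
  have hk2 : (2 : ℝ) ≤ k := by exact_mod_cast hk
  have hsum0 : 0 ≤ ∑ t ∈ Finset.Ico 1 k, Real.exp (etaStep η τ' t) :=
    Finset.sum_nonneg fun t _ => (Real.exp_pos _).le
  have hE1 : 1 ≤ E := by linarith
  have hkE : (k : ℝ) ≤ E := by
    have h1 : ∑ t ∈ Finset.Ico 1 k, (1 : ℝ) ≤ ∑ t ∈ Finset.Ico 1 k, Real.exp (etaStep η τ' t) :=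
      Finset.sum_le_sum fun t _ => Real.one_le_exp (etaStep_nonneg hη t)
    rw [Finset.sum_const, Nat.card_Ico, nsmul_eq_mul, mul_one, Nat.cast_sub (by lia)] at h1
    push_cast at h1
    linarith
  -- Here `τ* = ν* = 5 r`, and only the case `5 r < 1` is left.
  set r := Real.sqrt ((k * τ' + ν * E) / η) with hr
  have hr2 : r ^ 2 * η = k * τ' + ν * E := by
    rw [hr, Real.sq_sqrt (by positivity)]; field_simp
  have hr0 : 0 < r := Real.sqrt_pos.2 (by positivity)
  obtain ⟨η', hη', hloss⟩ := exists_gt_concentratedLoss_le_etaStep hη hτ' hτ'1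
  set g : ℕ → ℝ := fun t => Real.sinh (momentOrder η' L t * η') / Real.sinh η' with hg
  have hη0 : 0 < η' := hη.trans hη'
  have hg0 : ∀ t, 0 ≤ g t := fun t => div_nonneg
    (Real.sinh_nonneg_iff.2 (by unfold momentOrder; positivity)) (Real.sinh_nonneg_iff.2 hη0.le)
  set G := ∑ t ∈ Finset.Icc 1 k, g t with hG
  have hG0 : 0 ≤ G := Finset.sum_nonneg fun t _ => hg0 t
  -- The first bound limits the effect of `δ` on the lost mass, `2 E δ ≤ τ'`; the second is the
  -- smallness required by the moment estimates.
  set δ := min (τ' / (2 * E)) (1 / (2 * k * (G + 1))) with hδ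
  have hδ0 : 0 < δ := lt_min (by positivity) (by positivity)
  have hδE : E * δ ≤ τ' / 2 := by
    have h1 : δ ≤ τ' / (2 * E) := min_le_left _ _
    rw [le_div_iff₀ (by positivity)] at h1
    linarith
  have hδk : ∀ t : ℕ, 1 ≤ t → t ≤ k → g t * δ ≤ 1 / (2 * k) := by
    intro t ht htk
    have h1 : δ ≤ 1 / (2 * k * (G + 1)) := min_le_right _ _
    have h2 : g t ≤ G := Finset.single_le_sum (fun t _ => hg0 t) (Finset.mem_Icc.2 ⟨ht, htk⟩)
    calc g t * δ ≤ (G + 1) * (1 / (2 * k * (G + 1))) := by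
          gcongr
          linarith
      _ = 1 / (2 * k) := by field_simp
  have hτr : 2 * τ' ≤ 2 * r ^ 2 := by nlinarith
  -- `τ* = 5 r` is split into the tail `2 τ'` and the Markov threshold `5 r - 2 τ'`, positive
  -- because `τ' ≤ r²` and `5 r < 1`.
  have hs : 0 < 5 * r - 2 * τ' := by nlinarith
  have hsumE : ∑ t ∈ Finset.range k, Real.exp (concentratedLoss η' L t) ≤ E := by
    rw [Finset.range_eq_Ico, Finset.sum_eq_sum_Ico_succ_bot (by lia), hE]
    refine add_le_add ?_ (Finset.sum_le_sum fun t ht => ?_)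
    · simp [concentratedLoss]
    · exact Real.exp_le_exp.2 (hloss t (Finset.mem_Ico.1 ht).1)
  have hβ : ∑ t ∈ Finset.range k, (Real.exp (concentratedLoss η' L t) * (ν + δ) +
      2 * Real.exp (-L)) + k * (ν + δ) ≤ 5 * r * (5 * r - 2 * τ') := by
    rw [Finset.sum_add_distrib, ← Finset.sum_mul, Finset.sum_const, Finset.card_range,
      nsmul_eq_mul, hexpL]
    have h1 : (∑ t ∈ Finset.range k, Real.exp (concentratedLoss η' L t)) * (ν + δ) ≤
        E * (ν + δ) := by gcongr
    have h2 : k * (ν + δ) ≤ E * (ν + δ) := by gcongr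
    -- The only use of `η ≤ 2`: the lost mass is at most `3 r² η`, and it has to be bounded by a
    -- multiple of `r²`.
    have h3 : 3 * (r ^ 2 * η) ≤ 6 * r ^ 2 := by nlinarith
    have h4 : 6 * r ^ 2 ≤ 5 * r * (5 * r - 2 * τ') := by nlinarith
    nlinarith
  refine (typicallyStable_adaptiveComposition_of_concentration h hη hη' hν hν1 hL.le hδ0 hs hδk
    hβ).mono ?_ ?_ le_rfl
  · exact (hloss k (by lia)).trans (etaStep_le_etaStar hη hτ' hτ'1 le_rfl)
  · rw [hexpL]; linarith

theorem natCast_le_sum_exp {x : ℝ} (hx : 0 ≤ x) (k : ℕ) :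
    (k : ℝ) ≤ ∑ t ∈ Finset.range k, Real.exp (t * x) := by
  calc (k : ℝ) = ∑ t ∈ Finset.range k, (1 : ℝ) := by simp
    _ ≤ _ := Finset.sum_le_sum fun t _ => Real.one_le_exp (by positivity)

/-- Composition of algorithms with large loss, up to an arbitrarily small error `γ`. -/
theorem satisfiesStability_of_sum (hη : 0 < η) (hν : 0 ≤ ν) (hν1 : ν < 1) {γ ε ν' : ℝ}
    (hγ : 0 < γ) (hk : 1 ≤ k) (hε : k * (3 / 2 * η) ≤ ε) (hν' : 0 < ν')
    (hβ : 2 * ((∑ t ∈ Finset.range k, Real.exp (t * (3 / 2 * η))) * ν + γ) ≤ ν' ^ 2) :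
    SatisfiesStabilityUnderComposition.{u, v} 𝓟 k η 0 ν ε ν' ν' := by
  intro Z _ _ 𝒜 _ h
  set S := ∑ t ∈ Finset.range k, Real.exp (t * (3 / 2 * η)) with hS
  have hkS : (k : ℝ) ≤ S := natCast_le_sum_exp (by positivity) k
  have hk1 : (1 : ℝ) ≤ k := by exact_mod_cast hk
  have hS0 : 0 < S := by linarith
  -- The factor `3/2` gives the required strict enlargement of `η`; `δ = γ / S` makes the total
  -- contribution of `δ` at most `2 γ`.
  refine (typicallyStable_adaptiveComposition_of_sum h hη (η' := 3 / 2 * η) (by linarith) hν hν1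
    (δ := γ / S) (by positivity) hν' (ν' := ν') ?_).mono hε le_rfl le_rfl
  rw [← Finset.sum_mul, ← hS]
  have h1 : k * (ν + γ / S) ≤ S * (ν + γ / S) := by gcongr
  have h2 : S * (ν + γ / S) = S * ν + γ := by field_simp
  nlinarith

/-- For `η > 2` one has `e^η - 1 ≥ 2`, so `η_t` exceeds the summed loss `3/2 t η` by at least `η /
2` for `t ≥ 1`. As `e^{η/2} ≥ η`, this excess absorbs the factor `1/η` in `ν*`. -/
theorem satisfiesStability_of_two_lt (hk : 2 ≤ k) (hη2 : 2 < η) (hν : 0 ≤ ν)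
    (hν1 : ν < 1) (hτ' : 0 < τ') (hτ'1 : τ' < 1) :
    SatisfiesStabilityUnderComposition.{u, v} 𝓟 k η 0 ν
      (etaStar k η τ') (nuStar k η ν τ') (nuStar k η ν τ') := by
  have hη : 0 < η := by linarith
  have hL : 0 < Real.log (1 / τ') := Real.log_pos ((one_lt_div hτ').2 hτ'1)
  have hk2 : (2 : ℝ) ≤ k := by exact_mod_cast hk
  have hexp : η ≤ Real.exp η - 1 := by linarith [Real.add_one_le_exp η]
  set F := ∑ t ∈ Finset.Ico 1 k, Real.exp (etaStep η τ' t) with hF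
  have hF0 : 0 ≤ F := Finset.sum_nonneg fun t _ => (Real.exp_pos _).le
  have hhalf : η ≤ Real.exp (η / 2) := by
    have h1 : Real.exp (η / 2) = Real.exp (η / 4) ^ 2 := by rw [← Real.exp_nat_mul]; ring_nf
    have h2 := Real.add_one_le_exp (η / 4)
    rw [h1]
    nlinarith [sq_nonneg (1 - η / 4)]
  have hstep : ∀ t : ℕ, 1 ≤ t →
      η * Real.exp (t * (3 / 2 * η)) ≤ Real.exp (etaStep η τ' t) := by
    intro t ht
    have ht1 : (1 : ℝ) ≤ t := by exact_mod_cast ht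
    calc η * Real.exp (t * (3 / 2 * η)) ≤ Real.exp (η / 2) * Real.exp (t * (3 / 2 * η)) := by
          gcongr
      _ = Real.exp (η / 2 + t * (3 / 2 * η)) := (Real.exp_add _ _).symm
      _ ≤ _ := by
          refine Real.exp_le_exp.2 ?_
          have h1 : 0 ≤ Real.sqrt (2 * t * Real.log (1 / τ')) * η := by positivity
          have h2 : t * η * 2 ≤ t * η * (Real.exp η - 1) := by gcongr; linarith
          have h3 : η ≤ t * η := by nlinarith
          rw [etaStep]
          nlinarith
  -- The term `t = 0` has no counterpart in `F`; a second copy of the term `t = 1`, present since `k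
  -- ≥ 2`, pays for it.
  have hsum : η * ∑ t ∈ Finset.range k, Real.exp (t * (3 / 2 * η)) ≤ 2 * F := by
    rw [Finset.range_eq_Ico, Finset.sum_eq_sum_Ico_succ_bot (by lia), mul_add, Finset.mul_sum,
      two_mul]
    refine add_le_add ?_ (Finset.sum_le_sum fun t ht => hstep t (Finset.mem_Ico.1 ht).1)
    have h1 : η * Real.exp ((0 : ℕ) * (3 / 2 * η)) ≤ Real.exp (etaStep η τ' 1) := by
      refine le_trans ?_ (hstep 1 le_rfl)
      gcongr
      norm_num
    exact h1.trans (Finset.single_le_sum (f := fun t => Real.exp (etaStep η τ' t))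
      (fun t _ => (Real.exp_pos _).le) (Finset.mem_Ico.2 ⟨le_rfl, by lia⟩))
  have hpos : 0 < (k * τ' + ν * (1 + F)) / η := by positivity
  refine satisfiesStability_of_sum hη hν hν1 (γ := k * τ' / η) (by positivity) (by lia) ?_ ?_ ?_
  · have h1 : 0 ≤ 3 * Real.sqrt (2 * k * Real.log (1 / τ')) * η := by positivity
    have h2 : 3 * k * η * 2 ≤ 3 * k * η * (Real.exp η - 1) := by gcongr; linarith
    have h3 : 0 < k * η := by positivity
    rw [etaStar]
    nlinarith
  · rw [nuStar_eq]
    have := Real.sqrt_pos.2 hpos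
    positivity
  · rw [nuStar_eq, mul_pow, Real.sq_sqrt hpos.le]
    set S := ∑ t ∈ Finset.range k, Real.exp (t * (3 / 2 * η)) with hS
    have h1 : S * ν ≤ 2 * F * ν / η := by
      rw [le_div_iff₀ hη]
      nlinarith
    have h2 : (k * τ' + ν * (1 + F)) / η = k * τ' / η + ν / η + F * ν / η := by ring
    have h3 : 0 ≤ ν / η := by positivity
    have h4 : 0 ≤ F * ν / η := by positivity
    have h5 : 0 ≤ k * τ' / η := by positivity
    have h6 : 2 * F * ν / η = 2 * (F * ν / η) := by ring
    rw [h2]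
    linarith

theorem satisfiesStability (hk : 2 ≤ k) (hη : 0 < η) (hν : 0 ≤ ν)
    (hν1 : ν < 1) (hτ' : 0 < τ') (hτ'1 : τ' < 1) :
    SatisfiesStabilityUnderComposition.{u, v} 𝓟 k η 0 ν
      (etaStar k η τ') (nuStar k η ν τ') (nuStar k η ν τ') := by
  rcases le_or_gt η 2 with h | h
  · exact satisfiesStability_of_le_two hk hη h hν hν1 hτ' hτ'1
  · exact satisfiesStability_of_two_lt hk h hν hν1 hτ' hτ'1

/-! ### The asymptotic form -/

theorem natCast_mul_le {c L : ℝ} (hL : 0 < L) (hk : 1 ≤ k)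
    (hηc : η ≤ c * Real.sqrt (L / k)) : k * η ≤ c * (Real.sqrt L * Real.sqrt k) := by
  have hk1 : (1 : ℝ) ≤ k := by exact_mod_cast hk
  have h1 : (k : ℝ) * Real.sqrt (L / k) = Real.sqrt L * Real.sqrt k := by
    rw [Real.sqrt_div hL.le]
    have h2 : Real.sqrt k ^ 2 = k := Real.sq_sqrt (by positivity)
    have h3 : 0 < Real.sqrt k := Real.sqrt_pos.2 (by positivity)
    field_simp
    rw [h2]
  calc k * η ≤ k * (c * Real.sqrt (L / k)) := by gcongr
    _ = c * (k * Real.sqrt (L / k)) := by ring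
    _ = _ := by rw [h1]

/-- For `η ≤ 2`, `e^η - 1 ≤ η e^η ≤ 9 η`, and the assumption gives `k η ≤ c √L √k`. Hence the second
term is at most `27 c √L √k η`, and `3 √2 ≤ 5` covers the first. -/
theorem etaStar_le_etaAsymp {c : ℝ} (hk : 2 ≤ k) (hη : 0 < η) (hη2 : η ≤ 2) (hτ' : 0 < τ')
    (hτ'1 : τ' < 1) (hηc : η ≤ c * Real.sqrt (Real.log (1 / τ') / k)) :
    etaStar k η τ' ≤ etaAsymp (5 + 27 * c) k η τ' := by
  have hL : 0 < Real.log (1 / τ') := Real.log_pos ((one_lt_div hτ').2 hτ'1)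
  have hkη := natCast_mul_le hL (by lia) hηc
  rw [etaStar, etaAsymp]
  set L := Real.log (1 / τ') with hLd
  set w := Real.sqrt L * Real.sqrt k with hw
  have hw0 : 0 ≤ w := by positivity
  have hexp : Real.exp η - 1 ≤ 9 * η := by
    have h1 : 1 - η ≤ Real.exp (-η) := by linarith [Real.add_one_le_exp (-η)]
    have h2 : Real.exp η * Real.exp (-η) = 1 := by rw [← Real.exp_add]; simp
    have h3 : Real.exp η ≤ 9 := by
      calc Real.exp η ≤ Real.exp 2 := Real.exp_le_exp.2 hη2
        _ = Real.exp 1 ^ 2 := by rw [← Real.exp_nat_mul]; norm_num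
        _ ≤ 3 ^ 2 := by have := Real.exp_one_lt_d9; gcongr; linarith
        _ = 9 := by norm_num
    have h4 := mul_le_mul_of_nonneg_left h1 (Real.exp_pos η).le
    nlinarith
  have hroot : Real.sqrt (2 * k * L) ≤ 3 / 2 * w := by
    have h1 : Real.sqrt (2 * k * L) = Real.sqrt 2 * w := by
      rw [hw, mul_assoc, Real.sqrt_mul (by norm_num), Real.sqrt_mul (by positivity)]; ring
    have h2 : Real.sqrt 2 ≤ 3 / 2 := Real.sqrt_le_iff.2 (by norm_num)
    rw [h1]
    gcongr
  calc 3 * Real.sqrt (2 * k * L) * η + 3 * k * η * (Real.exp η - 1)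
      ≤ 3 * (3 / 2 * w) * η + 3 * k * η * (9 * η) := by gcongr
    _ = 9 / 2 * (w * η) + 27 * (k * η) * η := by ring
    _ ≤ 5 * (w * η) + 27 * (c * w) * η := by
        have : 0 ≤ w * η := by positivity
        gcongr
        norm_num
    _ = _ := by rw [hw]; ring

/-- Every `η_t` is at most `X`, so the bracket multiplying `ν` is at most `k e^X`; the rest is
subadditivity of the square root and `e^{X/2} ≤ e^X`. -/
theorem nuStar_le_nuAsymp {A : ℝ} (hk : 2 ≤ k) (hη : 0 < η) (hν : 0 ≤ ν) (hτ' : 0 < τ')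
    (hτ'1 : τ' < 1) (hA : 5 ≤ A) (hle : etaStar k η τ' ≤ etaAsymp A k η τ') :
    nuStar k η ν τ' ≤ nuAsymp A k η ν τ' := by
  have hk2 : (2 : ℝ) ≤ k := by exact_mod_cast hk
  set X := etaAsymp A k η τ' with hX
  have hX0 : 0 ≤ X := by rw [hX, etaAsymp]; positivity
  have hF : 1 + ∑ t ∈ Finset.Ico 1 k, Real.exp (etaStep η τ' t) ≤ k * Real.exp X := by
    have h1 : ∑ t ∈ Finset.Ico 1 k, Real.exp (etaStep η τ' t) ≤
        ∑ t ∈ Finset.Ico 1 k, Real.exp X := Finset.sum_le_sum fun t ht => Real.exp_le_exp.2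
      ((etaStep_le_etaStar hη hτ' hτ'1 (Finset.mem_Ico.1 ht).2.le).trans hle)
    rw [Finset.sum_const, Nat.card_Ico, nsmul_eq_mul, Nat.cast_sub (by lia)] at h1
    push_cast at h1
    have h2 : 1 ≤ Real.exp X := Real.one_le_exp hX0
    linarith
  have hexp2 : Real.exp X ≤ Real.exp X ^ 2 := by
    have h2 : 1 ≤ Real.exp X := Real.one_le_exp hX0
    nlinarith
  rw [nuStar_eq, nuAsymp, ← hX]
  gcongr
  refine Real.sqrt_le_iff.2 ⟨by positivity, ?_⟩
  set a := Real.sqrt (k * τ' / η) with ha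
  set b := Real.sqrt (k * ν / η) with hb
  have ha2 : a ^ 2 = k * τ' / η := Real.sq_sqrt (by positivity)
  have hb2 : b ^ 2 = k * ν / η := Real.sq_sqrt (by positivity)
  calc _ ≤ (k * τ' + ν * (k * Real.exp X)) / η := by gcongr
    _ = a ^ 2 + b ^ 2 * Real.exp X := by rw [ha2, hb2]; ring
    _ ≤ a ^ 2 + b ^ 2 * Real.exp X ^ 2 := by gcongr
    _ ≤ (a + b * Real.exp X) ^ 2 := by
        have : 0 ≤ a * (b * Real.exp X) := by positivity
        nlinarith

/-- Here `e^η - 1` is not of order `η`, so the bound through `η*` is unavailable. But `2 < η` and `k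
η ≤ c √L √k` force `2 k ≤ c √L √k`, so the plain sum of the losses is already of the desired form.
Being at most `X / 2`, it also leaves room to absorb `1/η`. -/
theorem satisfiesStability_asymp_of_two_lt {c : ℝ} (hc : 0 < c) (hk : 2 ≤ k) (hη2 : 2 < η)
    (hν : 0 ≤ ν) (hν1 : ν < 1) (hτ' : 0 < τ') (hτ'1 : τ' < 1)
    (hηc : η ≤ c * Real.sqrt (Real.log (1 / τ') / k)) :
    SatisfiesStabilityUnderComposition.{u, v} 𝓟 k η 0 ν (etaAsymp (5 + 27 * c) k η τ')
      (nuAsymp (5 + 27 * c) k η ν τ') (nuAsymp (5 + 27 * c) k η ν τ') := by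
  have hη : 0 < η := by linarith
  have hL : 0 < Real.log (1 / τ') := Real.log_pos ((one_lt_div hτ').2 hτ'1)
  have hk2 : (2 : ℝ) ≤ k := by exact_mod_cast hk
  have hkη := natCast_mul_le hL (by lia) hηc
  set X := etaAsymp (5 + 27 * c) k η τ' with hX
  have hkX : 2 * (k * (3 / 2 * η)) ≤ X := by
    rw [hX, etaAsymp]
    set w := Real.sqrt (Real.log (1 / τ')) * Real.sqrt k with hw
    have hw0 : 0 ≤ w := by positivity
    have h1 : 2 * (k : ℝ) ≤ c * w := by nlinarith
    calc 2 * (k * (3 / 2 * η)) = 2 * k * η * (3 / 2) := by ring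
      _ ≤ c * w * η * (3 / 2) := by gcongr
      _ ≤ (5 + 27 * c) * (w * η) := by
          have : 0 ≤ w * η := by positivity
          nlinarith [mul_nonneg hc.le this]
      _ = _ := by rw [hw]; ring
  set a := Real.sqrt (k * τ' / η) with ha
  set b := Real.sqrt (k * ν / η) with hb
  have ha0 : 0 < a := Real.sqrt_pos.2 (by positivity)
  have hb0 : 0 ≤ b := Real.sqrt_nonneg _
  have ha2 : a ^ 2 = k * τ' / η := Real.sq_sqrt (by positivity)
  have hb2 : b ^ 2 * η = k * ν := by rw [hb, Real.sq_sqrt (by positivity)]; field_simp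
  have hnu : nuAsymp (5 + 27 * c) k η ν τ' = (5 + 27 * c) * (a + b * Real.exp X) := rfl
  have hb0' : 0 ≤ b * Real.exp X := by positivity
  refine satisfiesStability_of_sum hη hν hν1 (γ := a ^ 2) (by positivity) (by lia) ?_ ?_ ?_
  · have : 0 < k * (3 / 2 * η) := by positivity
    linarith
  · rw [hnu]; positivity
  · have h1 : ∑ t ∈ Finset.range k, Real.exp (t * (3 / 2 * η)) ≤
        k * Real.exp (k * (3 / 2 * η)) := by
      calc _ ≤ ∑ t ∈ Finset.range k, Real.exp (k * (3 / 2 * η)) := by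
            refine Finset.sum_le_sum fun t ht => ?_
            have : t ≤ k := (Finset.mem_range.1 ht).le
            gcongr
        _ = _ := by simp
    have h2 : η ≤ Real.exp (k * (3 / 2 * η)) := by
      have h3 := Real.add_one_le_exp (k * (3 / 2 * η))
      nlinarith
    have h3 : (∑ t ∈ Finset.range k, Real.exp (t * (3 / 2 * η))) * ν ≤ (b * Real.exp X) ^ 2 := by
      calc _ ≤ k * Real.exp (k * (3 / 2 * η)) * ν := by gcongr
        _ = b ^ 2 * (η * Real.exp (k * (3 / 2 * η))) := by
            linear_combination (-Real.exp (k * (3 / 2 * η))) * hb2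
        _ ≤ b ^ 2 * (Real.exp (k * (3 / 2 * η)) * Real.exp (k * (3 / 2 * η))) := by gcongr
        _ = b ^ 2 * Real.exp (2 * (k * (3 / 2 * η))) := by rw [← Real.exp_add]; ring_nf
        _ ≤ b ^ 2 * Real.exp (2 * X) := by
            have : 0 ≤ X := by
              have : 0 < k * (3 / 2 * η) := by positivity
              linarith
            gcongr
            linarith
        _ = _ := by rw [mul_pow, ← Real.exp_nat_mul]; norm_num
    rw [hnu, mul_pow]
    have h4 : (b * Real.exp X) ^ 2 + a ^ 2 ≤ (a + b * Real.exp X) ^ 2 := by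
      nlinarith [mul_nonneg ha0.le hb0']
    have h5 : 2 ≤ (5 + 27 * c) ^ 2 := by nlinarith
    have h6 := mul_le_mul_of_nonneg_right h5 (sq_nonneg (a + b * Real.exp X))
    linarith

end Stability

theorem mainTheorem1 :
    (∀ (X : Type u) [MeasurableSpace X] (n : ℕ) (𝓟 : Set (ProbabilityMeasure (Fin n → X)))
      (k : ℕ), 2 ≤ k → ∀ η ν τ' : ℝ, 0 < η → 0 ≤ ν → ν < 1 → 0 < τ' → τ' < 1 →
        SatisfiesStabilityUnderComposition.{u, v} 𝓟 k η 0 ν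
          (etaStar k η τ') (nuStar k η ν τ') (nuStar k η ν τ')) ∧
    (∀ c : ℝ, 0 < c → ∃ A : ℝ, 0 < A ∧
      ∀ (X : Type u) [MeasurableSpace X] (n : ℕ) (𝓟 : Set (ProbabilityMeasure (Fin n → X)))
        (k : ℕ), 2 ≤ k → ∀ η ν τ' : ℝ, 0 < η → 0 ≤ ν → ν < 1 → 0 < τ' → τ' < 1 →
          η ≤ c * Real.sqrt (Real.log (1 / τ') / k) →
            SatisfiesStabilityUnderComposition.{u, v} 𝓟 k η 0 ν
              (etaAsymp A k η τ') (nuAsymp A k η ν τ') (nuAsymp A k η ν τ')) := by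
  refine ⟨fun X _ n 𝓟 k hk η ν τ' hη hν hν1 hτ' hτ'1 => satisfiesStability hk hη hν hν1 hτ' hτ'1,
    fun c hc => ⟨5 + 27 * c, by positivity, ?_⟩⟩
  intro X _ n 𝓟 k hk η ν τ' hη hν hν1 hτ' hτ'1 hηc
  rcases le_or_gt η 2 with hη2 | hη2
  · have h1 := etaStar_le_etaAsymp hk hη hη2 hτ' hτ'1 hηc
    have h2 := nuStar_le_nuAsymp hk hη hν hτ' hτ'1 (by linarith) h1
    intro Z _ _ 𝒜 _ h
    exact (satisfiesStability hk hη hν hν1 hτ' hτ'1 Z 𝒜 h).mono h1 h2 h2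
  · exact satisfiesStability_asymp_of_two_lt hc hk hη2 hν hν1 hτ' hτ'1 hηc
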